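/- \textbf{Setting.} Let $X$ be a $\sigma$-compact locally compact space and $\nu$ a measure on a $\sigma$-algebra of $X$ containing the Borel sets (for instance the completion of a Borel measure). Let $(\mathcal K_\lambda)_{\lambda\in X}$ be separable complex Hilbert spaces, and let the separable complex Hilbert space $\mathcal K=\int_X^\oplus\mathcal K_\lambda\,d\nu(\lambda)$ be their direct integral. That is, to each $\xi\in\mathcal K$ there corresponds a function $\lambda\mapsto\xi(\lambda)\in\mathcal K_\lambda$ such that (i) for all $\xi,\eta\in\mathcal K$ the function $\lambda\mapsto\langle\xi(\lambda),\eta(\lambda)\rangle$ is $\nu$-integrable and $\langle\xi,\eta\rangle=\int_X\langle\xi(\lambda),\eta(\lambda)\rangle\,d\nu(\lambda)$; (ii) if $\phi_\lambda\in\mathcal K_\lambda$ for all $\lambda$ and $\lambda\mapsto\langle\phi_\lambda,\eta(\lambda)\rangle$ is integrable for every $\eta\in\mathcal K$, then there is $\phi\in\mathcal K$ with $\phi(\lambda)=\phi_\lambda$ for almost every $\lambda$. For a possibly unbounded operator $A$ on $\mathcal K$ and possibly unbounded operators $A_\lambda$ on $\mathcal K_\lambda$ write $A=\int_X^\oplus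 A_\lambda\,d\nu(\lambda)$ if for each $\xi\in\mathcal D(A)$, for $\nu$-almost every $\lambda$, one has $\xi(\lambda)\in\mathcal D(A_\lambda)$ and $(A\xi)(\lambda)=A_\lambda\xi(\lambda)$. For a self-adjoint operator $S$ let $E^S$ be its spectral (projection-valued) measure, let $f(S)=\int f\,dE^S$ for Borel $f:\mathbb R\to\mathbb C$, with domain $\{\xi:\int|f|^2\,d\langle\xi,E^S\xi\rangle<\infty\}$, and let $e^{itS}$ be given by this functional calculus. \textbf{Theorem.} Let $T$ be a self-adjoint operator on $\mathcal K$. The following are equivalent: (1) there are self-adjoint operators $T_\lambda$ on $\mathcal K_\lambda$ with $E^T=\int_X^\oplus E^{T_\lambda}\,d\nu(\lambda)$, i.e. $E^T(\Omega)=\int_X^\oplus E^{T_\lambda}(\Omega)\,d\nu(\lambda)$ for every Borel set $\Omega\subseteq\mathbb R$; (2) there are self-adjoint operators $T_\lambda$ on $\mathcal K_\lambda$ with $f(T)=\int_X^\oplus f(T_\lambda)\,d\nu(\lambda)$ for every Borel function $f:\mathbb R\to\mathbb C$; (3) there are self-adjoint operators $T_\lambda$ on $\mathcal K_\lambda$ with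 $T=\int_X^\oplus T_\lambda\,d\nu(\lambda)$; (4) there are strongly continuous one-parameter groups of unitaries $(U_\lambda(t))_{t\in\mathbb R}$ on $\mathcal K_\lambda$ with $e^{itT}=\int_X^\oplus U_\lambda(t)\,d\nu(\lambda)$ for every $t\in\mathbb R$. Moreover, the fibres correspond: for any fixed family of self-adjoint operators $T_\lambda$ on $\mathcal K_\lambda$, the identities in (1), (2), (3), and (4) with $U_\lambda(t)=e^{itT_\lambda}$, are equivalent to each other. -/

import Mathlib

open MeasureTheory

noncomputable section

/-! ### Projection-valued measures and the Borel functional calculus -/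

/-- A (normalised, strongly countably additive) projection-valued measure on the Borel sets of `ℝ`
with values in the orthogonal projections of the Hilbert space `H`. Sets that are not Borel are
sent to `0`, so that a projection-valued measure is determined by its values on Borel sets. -/
structure ProjectionValuedMeasure (H : Type*) [NormedAddCommGroup H] [InnerProductSpace ℂ H]
    [CompleteSpace H] where
  /-- the projection `E(Ω)` -/
  proj : Set ℝ → H →L[ℂ] H
  isStarProjection : ∀ Ω, MeasurableSet Ω → IsStarProjection (proj Ω)
  proj_empty : proj ∅ = 0
  proj_univ : proj Set.univ = 1
  proj_inter : ∀ Ω₁ Ω₂, MeasurableSet Ω₁ → MeasurableSet Ω₂ →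
    proj (Ω₁ ∩ Ω₂) = proj Ω₁ * proj Ω₂
  hasSum_iUnion : ∀ Ω : ℕ → Set ℝ, (∀ n, MeasurableSet (Ω n)) →
    Pairwise (Function.onFun Disjoint Ω) →
    ∀ ξ : H, HasSum (fun n => proj (Ω n) ξ) (proj (⋃ n, Ω n) ξ)
  proj_of_not_measurable : ∀ Ω, ¬ MeasurableSet Ω → proj Ω = 0

namespace ProjectionValuedMeasure

variable {H : Type*} [NormedAddCommGroup H] [InnerProductSpace ℂ H] [CompleteSpace H]

theorem re_inner_proj_nonneg (E : ProjectionValuedMeasure H) (ξ : H) {Ω : Set ℝ}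
    (hΩ : MeasurableSet Ω) : 0 ≤ (inner ℂ ξ (E.proj Ω ξ)).re := by
  have h := E.isStarProjection Ω hΩ
  have h1 : E.proj Ω ξ = E.proj Ω (E.proj Ω ξ) := by
    conv_lhs => rw [← h.isIdempotentElem.eq]
    rfl
  have h2 : inner ℂ ξ (E.proj Ω ξ) = inner ℂ (E.proj Ω ξ) (E.proj Ω ξ) := by
    conv_lhs => rw [h1]
    rw [← ContinuousLinearMap.adjoint_inner_left, ← ContinuousLinearMap.star_eq_adjoint,
      h.isSelfAdjoint.star_eq]
  rw [h2]
  exact inner_self_nonneg (𝕜 := ℂ)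

/-- The finite Borel measure `E_ξ(Ω) = ⟨ξ, E(Ω) ξ⟩` of a vector `ξ`. -/
def measure (E : ProjectionValuedMeasure H) (ξ : H) : Measure ℝ :=
  Measure.ofMeasurable (fun Ω _ => ENNReal.ofReal (inner ℂ ξ (E.proj Ω ξ)).re)
    (by simp [E.proj_empty])
    (by
      intro Ω hΩ hd
      have h := (E.hasSum_iUnion Ω hΩ hd ξ).mapL (Complex.reCLM ∘L
        ((innerSL ℂ ξ).restrictScalars ℝ))
      have h' : HasSum (fun n => (inner ℂ ξ (E.proj (Ω n) ξ)).re)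
          (inner ℂ ξ (E.proj (⋃ n, Ω n) ξ)).re := h
      rw [← h'.tsum_eq]
      exact ENNReal.ofReal_tsum_of_nonneg
        (fun n => E.re_inner_proj_nonneg ξ (hΩ n)) h'.summable)

/-- The unit mass at `0`. -/
instance : Nonempty (ProjectionValuedMeasure H) := by
  classical
  refine ⟨⟨fun Ω => if MeasurableSet Ω ∧ (0 : ℝ) ∈ Ω then 1 else 0, ?_, ?_, ?_, ?_, ?_, ?_⟩⟩
  · intro Ω _
    split_ifs
    · exact IsStarProjection.one _
    · exact IsStarProjection.zero _
  · simp
  · simp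
  · intro A B hA hB
    by_cases a : (0 : ℝ) ∈ A <;> by_cases b : (0 : ℝ) ∈ B <;> simp [hA, hB, hA.inter hB, a, b]
  · intro Ω hΩ hd ξ
    have hU := MeasurableSet.iUnion hΩ
    by_cases h : ∃ n, (0 : ℝ) ∈ Ω n
    · obtain ⟨n, hn⟩ := h
      have h0 : ∀ m, m ≠ n → (0 : ℝ) ∉ Ω m := fun m hm h' =>
        Set.disjoint_left.1 (hd hm) h' hn
      have hn' : (0 : ℝ) ∈ ⋃ n, Ω n := Set.mem_iUnion.2 ⟨n, hn⟩
      have := hasSum_single (f := fun m =>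
        (if MeasurableSet (Ω m) ∧ (0 : ℝ) ∈ Ω m then (1 : H →L[ℂ] H) else 0) ξ) n
        (fun m hm => by simp [h0 m hm])
      simpa only [hΩ n, hn, hU, hn', and_self, if_true] using this
    · have h' : (0 : ℝ) ∉ ⋃ n, Ω n := by simpa using h
      push Not at h
      simp only [h, h', and_false, if_false, zero_apply]
      exact hasSum_zero
  · intro Ω h
    simp [h]

/-- `A = ∫ f dE` for a Borel function `f`: the domain of `A` is `{ξ | ∫ |f|² dE_ξ < ∞}`, and
`⟨ξ, A ξ⟩ = ∫ f dE_ξ` for all `ξ` in it. By polarisation at most one operator `A` is such. -/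
structure IsIntegral (E : ProjectionValuedMeasure H) (f : ℝ → ℂ) (A : H →ₗ.[ℂ] H) : Prop where
  mem_domain_iff : ∀ ξ : H, ξ ∈ A.domain ↔ MemLp f 2 (E.measure ξ)
  inner_apply : ∀ ξ : A.domain, inner ℂ (ξ : H) (A ξ) = ∫ s, f s ∂(E.measure (ξ : H))

/-- The (in general unbounded) operator `∫ f dE`, for a Borel function `f`. -/
def integral (E : ProjectionValuedMeasure H) (f : ℝ → ℂ) : H →ₗ.[ℂ] H :=
  Classical.epsilon (E.IsIntegral f)

end ProjectionValuedMeasure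

section FunctionalCalculus

variable {H : Type*} [NormedAddCommGroup H] [InnerProductSpace ℂ H] [CompleteSpace H]

/-- The spectral measure `E^T` of a self-adjoint operator `T`: the unique projection-valued measure
`E` such that `T = ∫ s dE(s)`. -/
def spectralMeasure (T : H →ₗ.[ℂ] H) : ProjectionValuedMeasure H :=
  Classical.epsilon fun E => E.IsIntegral (fun s : ℝ => (s : ℂ)) T

/-- The Borel functional calculus `f(T) = ∫ f dE^T` of a self-adjoint operator `T`. -/
def borelCalculus (T : H →ₗ.[ℂ] H) (f : ℝ → ℂ) : H →ₗ.[ℂ] H :=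
  (spectralMeasure T).integral f

/-- The operator `e^{itT}`, given by the functional calculus. -/
def expI (T : H →ₗ.[ℂ] H) (t : ℝ) : H →ₗ.[ℂ] H :=
  borelCalculus T fun s => Complex.exp (Complex.I * t * s)

/-- Strongly continuous one-parameter groups of unitary operators. -/
structure IsOneParameterUnitaryGroup (U : ℝ → H →L[ℂ] H) : Prop where
  mem_unitary : ∀ t, U t ∈ unitary (H →L[ℂ] H)
  map_zero : U 0 = 1
  map_add : ∀ s t, U (s + t) = U s * U t
  continuous : ∀ ξ : H, Continuous fun t => U t ξ

end FunctionalCalculus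

/-! ### Direct integrals -/

/-- A presentation of the Hilbert space `K` as the direct integral over `(X, ν)` of the Hilbert
spaces `𝓚 x`: to each `ξ : K` there corresponds a function `x ↦ ξ(x) ∈ 𝓚 x` such that
the inner product of `K` is the integral of the fibrewise ones, and each field of vectors that pairs
integrably with all elements of `K` comes from an element of `K`. -/
structure DirectIntegral {X : Type*} [MeasurableSpace X] (ν : Measure X)
    (𝓚 : X → Type*) [∀ x, NormedAddCommGroup (𝓚 x)] [∀ x, InnerProductSpace ℂ (𝓚 x)]
    (K : Type*) [NormedAddCommGroup K] [InnerProductSpace ℂ K] where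
  /-- the value `ξ(x)` -/
  fibre : K → ∀ x, 𝓚 x
  integrable_inner : ∀ ξ η : K, Integrable (fun x => inner ℂ (fibre ξ x) (fibre η x)) ν
  inner_eq : ∀ ξ η : K, inner ℂ ξ η = ∫ x, inner ℂ (fibre ξ x) (fibre η x) ∂ν
  exists_of_integrable : ∀ φ : ∀ x, 𝓚 x,
    (∀ η : K, Integrable (fun x => inner ℂ (φ x) (fibre η x)) ν) →
    ∃ ξ : K, ∀ᵐ x ∂ν, fibre ξ x = φ x

namespace DirectIntegral

variable {X : Type*} [MeasurableSpace X] {ν : Measure X}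
  {𝓚 : X → Type*} [∀ x, NormedAddCommGroup (𝓚 x)] [∀ x, InnerProductSpace ℂ (𝓚 x)]
  {K : Type*} [NormedAddCommGroup K] [InnerProductSpace ℂ K]

/-- `A = ∫^⊕ A_x dν(x)` for bounded operators: for every `ξ`, one has `(A ξ)(x) = A_x ξ(x)` for
almost every `x`. -/
def DecomposesBounded (D : DirectIntegral ν 𝓚 K) (A : K →L[ℂ] K) (a : ∀ x, 𝓚 x →L[ℂ] 𝓚 x) : Prop :=
  ∀ ξ : K, ∀ᵐ x ∂ν, D.fibre (A ξ) x = a x (D.fibre ξ x)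

/-- `A = ∫^⊕ A_x dν(x)` for possibly unbounded operators: for every `ξ` in the domain of `A`,
for almost every `x`, `ξ(x)` is in the domain of `A_x` and `(A ξ)(x) = A_x ξ(x)`. -/
def Decomposes (D : DirectIntegral ν 𝓚 K) (A : K →ₗ.[ℂ] K) (a : ∀ x, 𝓚 x →ₗ.[ℂ] 𝓚 x) : Prop :=
  ∀ ξ : A.domain, ∀ᵐ x ∂ν, ∃ h : D.fibre (ξ : K) x ∈ (a x).domain,
    D.fibre (A ξ) x = a x ⟨D.fibre (ξ : K) x, h⟩

/-- `E = ∫^⊕ E_x dν(x)` for projection-valued measures. -/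
def DecomposesPVM [CompleteSpace K] [∀ x, CompleteSpace (𝓚 x)] (D : DirectIntegral ν 𝓚 K)
    (E : ProjectionValuedMeasure K) (e : ∀ x, ProjectionValuedMeasure (𝓚 x)) : Prop :=
  ∀ Ω : Set ℝ, MeasurableSet Ω → D.DecomposesBounded (E.proj Ω) fun x => (e x).proj Ω

end DirectIntegral

end

/-!
The four conditions are linked, for fixed fibre operators `T_x`, by the bounded Borel functional
calculus. The class of bounded Borel functions `f` for which `f(T)` decomposes into the `f(T_x)`
is closed under linear combinations and under pointwise limits of uniformly bounded sequences
(`DirectIntegral.isBoundedClosed_decomposesBounded`): such limits turn into strong limits of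
operators, and a convergent sequence in the direct integral has a subsequence converging in almost
every fibre (`DirectIntegral.exists_subseq_tendsto_fibre`). The indicator functions generate all
bounded Borel functions in this sense, and so do the exponentials `e^{its}`
(`IsBoundedClosed.of_indicator`, `IsBoundedClosed.of_cexp`). Hence decomposing the spectral
measure, the bounded Borel functions of `T`, or the group `e^{itT}` are the same thing. Unbounded
Borel functions follow by truncation: for `ξ` in the domain of `f(T)` the truncated operators
converge on `ξ`, hence on almost every `ξ(x)` along a subsequence, and their boundedness on `ξ(x)`
puts `ξ(x)` in the domain of `f(T_x)` (`DirectIntegral.DecomposesPVM.integral`).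

The step that starts from `T` alone goes through resolvents. If `η = (1 - iaT) ξ` and `T`
decomposes, then `η(x) = (1 - iaT_x) ξ(x)` almost everywhere, and injectivity of `1 - iaT_x`
identifies `ξ(x)` with `(1 - iaT_x)⁻¹ η(x)` (`DirectIntegral.Decomposes.resolvent`). So the
resolvents decompose, with their powers, and `e^{its} = lim (1 - its/n)⁻ⁿ` boundedly in `s`.

For the existence statements a unitary group in each fibre has to be written as `e^{itT_x}`, which
is Stone's theorem (`IsOneParameterUnitaryGroup.exists_expI_eq`).

The operators involved are characterised by their properties, so their existence and uniqueness
are needed first. A projection-valued measure has a bounded Borel calculus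
(`ProjectionValuedMeasure.isBorelCalculus`) and unbounded integrals, the limits of truncations
(`ProjectionValuedMeasure.exists_isIntegral_tendsto`,
`ProjectionValuedMeasure.IsIntegral.unique`). The spectral theorem `exists_isIntegral_id` uses the
continuous functional calculus of the normal operator `(T + i)⁻¹`, whose spectrum lies on the
circle of the points `1/(s + i)`. It restricts to a nondegenerate representation of `C_c(ℝ)`; the
Riesz–Markov–Kakutani theorem gives the scalar spectral measures, and bounded limits give the
projections.
-/

/-! ### Classes of bounded Borel functions closed under bounded pointwise limits -/

section BoundedBorel

open Filter Topology Set

/-- Bounded Borel functions `ℝ → ℂ`. -/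
def IsBoundedBorel (f : ℝ → ℂ) : Prop := Measurable f ∧ ∃ C, ∀ s, ‖f s‖ ≤ C

namespace IsBoundedBorel

variable {f g : ℝ → ℂ}

theorem add (hf : IsBoundedBorel f) (hg : IsBoundedBorel g) : IsBoundedBorel (f + g) := by
  obtain ⟨C, hC⟩ := hf.2
  obtain ⟨B, hB⟩ := hg.2
  exact ⟨hf.1.add hg.1, C + B, fun s => (norm_add_le _ _).trans (add_le_add (hC s) (hB s))⟩

theorem smul (c : ℂ) (hf : IsBoundedBorel f) : IsBoundedBorel (c • f) := by
  obtain ⟨C, hC⟩ := hf.2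
  refine ⟨hf.1.const_smul c, ‖c‖ * C, fun s => ?_⟩
  rw [Pi.smul_apply, norm_smul]
  exact mul_le_mul_of_nonneg_left (hC s) (norm_nonneg c)

theorem sub (hf : IsBoundedBorel f) (hg : IsBoundedBorel g) : IsBoundedBorel (f - g) := by
  have h := hf.add (hg.smul (-1))
  simpa [sub_eq_add_neg] using h

theorem mul (hf : IsBoundedBorel f) (hg : IsBoundedBorel g) : IsBoundedBorel (f * g) := by
  obtain ⟨C, hC⟩ := hf.2
  obtain ⟨B, hB⟩ := hg.2
  refine ⟨hf.1.mul hg.1, C * B, fun s => ?_⟩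
  rw [Pi.mul_apply, norm_mul]
  exact mul_le_mul (hC s) (hB s) (norm_nonneg _) ((norm_nonneg _).trans (hC s))

theorem star (hf : IsBoundedBorel f) : IsBoundedBorel (star f) := by
  obtain ⟨C, hC⟩ := hf.2
  refine ⟨continuous_star.measurable.comp hf.1, C, fun s => ?_⟩
  rw [Pi.star_apply, norm_star]
  exact hC s

theorem const (c : ℂ) : IsBoundedBorel fun _ => c :=
  ⟨measurable_const, ‖c‖, fun _ => le_rfl⟩

theorem indicator {Ω : Set ℝ} (hΩ : MeasurableSet Ω) : IsBoundedBorel (Ω.indicator 1) := by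
  refine ⟨measurable_one.indicator hΩ, 1, fun s => ?_⟩
  by_cases h : s ∈ Ω <;> simp [h]

theorem of_hasCompactSupport (hf : Continuous f) (h : HasCompactSupport f) : IsBoundedBorel f :=
  ⟨hf.measurable, hf.bounded_above_of_compact_support h⟩

theorem cexp (t : ℝ) : IsBoundedBorel fun s => Complex.exp (Complex.I * t * s) := by
  refine ⟨by fun_prop, 1, fun s => ?_⟩
  have : Complex.I * t * s = ((t * s : ℝ) : ℂ) * Complex.I := by push_cast; ring
  exact (congrArg (fun z => ‖Complex.exp z‖) this).le.trans
    (Complex.norm_exp_ofReal_mul_I _).le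

theorem integrable (hf : IsBoundedBorel f) (μ : Measure ℝ) [IsFiniteMeasure μ] :
    Integrable f μ := by
  obtain ⟨C, hC⟩ := hf.2
  exact Integrable.of_bound hf.1.aestronglyMeasurable C (ae_of_all _ hC)

end IsBoundedBorel

/-- A property of functions `ℝ → ℂ` which, among bounded Borel functions, is stable under linear
combinations and under pointwise limits of uniformly bounded sequences. -/
structure IsBoundedClosed (P : (ℝ → ℂ) → Prop) : Prop where
  add : ∀ f g, IsBoundedBorel f → IsBoundedBorel g → P f → P g → P (f + g)
  smul : ∀ (c : ℂ) f, IsBoundedBorel f → P f → P (c • f)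
  lim : ∀ (F : ℕ → ℝ → ℂ) (f : ℝ → ℂ) (C : ℝ), (∀ n, Measurable (F n)) → Measurable f →
    (∀ n s, ‖F n s‖ ≤ C) → (∀ s, Tendsto (fun n => F n s) atTop (𝓝 (f s))) →
    (∀ n, P (F n)) → P f

namespace IsBoundedClosed

variable {P : (ℝ → ℂ) → Prop}

theorem of_indicator (hP : IsBoundedClosed P)
    (h : ∀ Ω : Set ℝ, MeasurableSet Ω → P (Ω.indicator 1)) (f : ℝ → ℂ) (hf : IsBoundedBorel f) :
    P f := by
  have hs : ∀ φ : SimpleFunc ℝ ℂ, IsBoundedBorel φ ∧ P φ := by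
    intro φ
    induction φ using SimpleFunc.induction with
    | const c hs =>
      rename_i Ω
      have : ⇑(SimpleFunc.piecewise Ω hs (SimpleFunc.const ℝ c) (SimpleFunc.const ℝ 0)) =
          c • Ω.indicator (1 : ℝ → ℂ) := by
        ext s
        by_cases hs' : s ∈ Ω <;> simp [hs']
      rw [this]
      exact ⟨(IsBoundedBorel.indicator hs).smul c,
        hP.smul _ _ (IsBoundedBorel.indicator hs) (h Ω hs)⟩
    | add hd hf hg =>
      exact ⟨hf.1.add hg.1, hP.add _ _ hf.1 hg.1 hf.2 hg.2⟩
  obtain ⟨hm, C, hC⟩ := hf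
  have hC0 : 0 ≤ C := (norm_nonneg _).trans (hC 0)
  refine hP.lim (fun n => hm.stronglyMeasurable.approxBounded C n) f C
    (fun n => SimpleFunc.measurable _) hm
    (fun n s => hm.stronglyMeasurable.norm_approxBounded_le hC0 n s)
    (fun s => hm.stronglyMeasurable.tendsto_approxBounded_of_norm_le (hC s)) fun n => (hs _).2

/-- The functions `min 1 (n · dist(s, (a, b)ᶜ))` increase to the indicator of `(a, b)`, and the open
intervals with rational endpoints are a π-system generating the Borel sets. -/
theorem of_hasCompactSupport (hP : IsBoundedClosed P)
    (h : ∀ f : ℝ → ℂ, Continuous f → HasCompactSupport f → P f) (f : ℝ → ℂ)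
    (hf : IsBoundedBorel f) : P f := by
  have hIoo : ∀ a b : ℝ, P ((Ioo a b).indicator 1) := by
    intro a b
    let F : ℕ → ℝ → ℂ := fun n s => ((min 1 (n * max 0 (min (s - a) (b - s))) : ℝ) : ℂ)
    have hF : ∀ n, Continuous (F n) := fun n => by fun_prop
    refine hP.lim F _ 1 (fun n => (hF n).measurable) (measurable_one.indicator measurableSet_Ioo)
      ?_ ?_ ?_
    · intro n s
      rw [Complex.norm_real, Real.norm_of_nonneg (by positivity)]
      exact min_le_left _ _
    · intro s
      by_cases hs : s ∈ Ioo a b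
      · have hpos : 0 < min (s - a) (b - s) := lt_min (sub_pos.2 hs.1) (sub_pos.2 hs.2)
        have := (tendsto_natCast_atTop_atTop (R := ℝ)).atTop_mul_const hpos
        refine tendsto_const_nhds.congr' ?_
        filter_upwards [this.eventually_ge_atTop 1] with n hn
        simp only [F, indicator_of_mem hs, max_eq_right hpos.le, min_eq_left hn]
        simp
      · have h0 : min (s - a) (b - s) ≤ 0 := by
          by_contra! hc
          exact hs ⟨by linarith [min_le_left (s - a) (b - s)],
            by linarith [min_le_right (s - a) (b - s)]⟩
        simp [F, indicator_of_notMem hs, max_eq_left h0]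
    · intro n
      refine h _ (hF n) (HasCompactSupport.intro (isCompact_Icc (a := a) (b := b)) ?_)
      intro s hs
      have h0 : min (s - a) (b - s) ≤ 0 := by
        by_contra! hc
        exact hs ⟨by linarith [min_le_left (s - a) (b - s)],
          by linarith [min_le_right (s - a) (b - s)]⟩
      simp [F, max_eq_left h0]
  have hone : P 1 := by
    refine hP.lim (fun n => (Ioo (-(n : ℝ)) n).indicator 1) 1 1
      (fun n => measurable_one.indicator measurableSet_Ioo) measurable_one ?_ ?_
      (fun n => hIoo _ _)
    · intro n s
      by_cases hs : s ∈ Ioo (-(n : ℝ)) n <;> simp [hs]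
    · intro s
      refine tendsto_const_nhds.congr' ?_
      filter_upwards [(tendsto_natCast_atTop_atTop (R := ℝ)).eventually_gt_atTop |s|] with n hn
      exact (indicator_of_mem (show s ∈ Ioo (-(n : ℝ)) n from abs_lt.1 hn) (1 : ℝ → ℂ)).symm
  refine hP.of_indicator (fun Ω hΩ => ?_) f hf
  have hzero : P 0 := by
    simpa using hP.smul 0 _ (IsBoundedBorel.const 1) hone
  have hborel : (inferInstance : MeasurableSpace ℝ) = MeasurableSpace.generateFrom
      (⋃ (a : ℚ) (b : ℚ) (_ : a < b), {Ioo (a : ℝ) (b : ℝ)}) := by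
    rw [← Real.borel_eq_generateFrom_Ioo_rat]
    exact BorelSpace.measurable_eq
  refine MeasurableSpace.induction_on_inter (C := fun Ω _ => P (Ω.indicator 1))
    hborel Real.isPiSystem_Ioo_rat ?_ ?_ ?_ ?_ Ω hΩ
  · simpa only [indicator_empty'] using hzero
  · intro t ht
    simp only [mem_iUnion, mem_singleton_iff] at ht
    obtain ⟨a, b, -, rfl⟩ := ht
    exact hIoo _ _
  · intro t ht hPt
    have h1 := IsBoundedBorel.indicator ht
    have := hP.add 1 _ (IsBoundedBorel.const 1) (h1.smul (-1)) hone (hP.smul (-1) _ h1 hPt)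
    convert this using 1
    ext s
    by_cases hs : s ∈ t <;> simp [hs]
  · intro Ω hd hm hPΩ
    have hsum : ∀ n, IsBoundedBorel ((⋃ i < n, Ω i).indicator 1) ∧
        P ((⋃ i < n, Ω i).indicator 1) := by
      intro n
      refine ⟨IsBoundedBorel.indicator
        (MeasurableSet.iUnion fun i => MeasurableSet.iUnion fun _ => hm i), ?_⟩
      induction n with
      | zero => simpa only [Nat.not_lt_zero, iUnion_of_empty, iUnion_empty, indicator_empty']
          using hzero
      | succ n ih =>
        have h1 : IsBoundedBorel ((⋃ i < n, Ω i).indicator 1) := IsBoundedBorel.indicator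
          (MeasurableSet.iUnion fun i => MeasurableSet.iUnion fun _ => hm i)
        have := hP.add _ _ h1 (IsBoundedBorel.indicator (hm n)) ih (hPΩ n)
        have hdisj : Disjoint (⋃ i < n, Ω i) (Ω n) := by
          rw [Set.disjoint_left]
          simp only [mem_iUnion, forall_exists_index]
          intro s i hi hs hs'
          exact Set.disjoint_left.1 (hd hi.ne) hs hs'
        have hU : (⋃ i < n + 1, Ω i) = (⋃ i < n, Ω i) ∪ Ω n := by
          ext s
          simp only [mem_iUnion, mem_union, Nat.lt_succ_iff_lt_or_eq]
          grind
        rw [hU, indicator_union_of_disjoint hdisj]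
        exact this
    refine hP.lim _ _ 1 (fun n => (hsum n).1.1)
      (measurable_one.indicator (MeasurableSet.iUnion hm)) ?_ ?_ (fun n => (hsum n).2)
    · intro n s
      by_cases hs : s ∈ ⋃ i < n, Ω i <;> simp [hs]
    · intro s
      refine tendsto_const_nhds.congr' ?_
      by_cases hs : ∃ i, s ∈ Ω i
      · obtain ⟨i, hi⟩ := hs
        filter_upwards [eventually_gt_atTop i] with n hn
        rw [indicator_of_mem (mem_iUnion.2 ⟨i, hi⟩),
          indicator_of_mem (mem_iUnion₂.2 ⟨i, hn, hi⟩)]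
      · refine Eventually.of_forall fun n => ?_
        push Not at hs
        have h1 : s ∉ ⋃ i, Ω i := by simpa using hs
        have h2 : s ∉ ⋃ i < n, Ω i := by simpa using fun i _ => hs i
        simp only [indicator_of_notMem h1, indicator_of_notMem h2]

/-- A continuous function supported in `(-T/2, T/2)` agrees there with its `T`-periodic
continuation, which is a uniform limit of trigonometric polynomials; now let `T → ∞`. -/
theorem of_cexp (hP : IsBoundedClosed P)
    (h : ∀ t : ℝ, P fun s => Complex.exp (Complex.I * t * s)) (f : ℝ → ℂ)
    (hf : IsBoundedBorel f) : P f := by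
  refine hP.of_hasCompactSupport (fun f hf hc => ?_) f hf
  -- by density of the trigonometric polynomials, `P` holds for all continuous periodic functions
  have hcirc : ∀ T : ℝ, 0 < T → ∀ G : C(AddCircle T, ℂ), P fun s => G (s : AddCircle T) := by
    intro T hT G
    have : Fact (0 < T) := ⟨hT⟩
    have hb : ∀ G : C(AddCircle T, ℂ), IsBoundedBorel fun s => G (s : AddCircle T) := fun G =>
      ⟨(G.continuous.comp (AddCircle.continuous_mk' T)).measurable, ‖G‖,
        fun s => G.norm_coe_le_norm _⟩
    have hspan : ∀ G ∈ Submodule.span ℂ (range (@fourier T)),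
        P fun s => G (s : AddCircle T) := by
      intro G hG
      induction hG using Submodule.span_induction with
      | mem x hx =>
        obtain ⟨n, rfl⟩ := hx
        convert h (2 * Real.pi * n / T) using 2 with s
        rw [fourier_coe_apply]
        congr 1
        push_cast
        ring
      | zero =>
        have := hP.smul 0 _ (IsBoundedBorel.cexp 0) (h 0)
        rw [zero_smul] at this
        exact this
      | add x y _ _ hx hy => exact hP.add _ _ (hb x) (hb y) hx hy
      | smul c x _ hx => exact hP.smul c _ (hb x) hx
    have hG : G ∈ (Submodule.span ℂ (range (@fourier T))).topologicalClosure := by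
      rw [span_fourier_closure_eq_top]
      trivial
    rw [← SetLike.mem_coe, Submodule.topologicalClosure_coe, mem_closure_iff_seq_limit] at hG
    obtain ⟨p, hp, hlim⟩ := hG
    obtain ⟨C, hC⟩ := (hlim.norm.bddAbove_range)
    refine hP.lim (fun n s => p n (s : AddCircle T)) _ C (fun n => (hb (p n)).1) (hb G).1 ?_ ?_
      (fun n => hspan _ (hp n))
    · exact fun n s => ((p n).norm_coe_le_norm _).trans (hC ⟨n, rfl⟩)
    · intro s
      exact ((continuous_eval_const (s : AddCircle T)).tendsto G).comp hlim
  obtain ⟨R, hR⟩ := hc.isCompact.isBounded.subset_ball_lt 0 0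
  obtain ⟨hR0, hR⟩ := hR
  have hout : ∀ s, R ≤ |s| → f s = 0 := by
    intro s hs
    by_contra hne
    have := hR (subset_tsupport f hne)
    rw [mem_ball_zero_iff, Real.norm_eq_abs] at this
    linarith
  have hT : ∀ n : ℕ, Fact (0 < 2 * (R + (n : ℝ))) := fun n => ⟨by positivity⟩
  obtain ⟨C, hC⟩ := hf.bounded_above_of_compact_support hc
  have hcont : ∀ n : ℕ, Continuous (AddCircle.liftIco (2 * (R + n)) (-(R + n)) f) := by
    intro n
    refine AddCircle.liftIco_continuous ?_ hf.continuousOn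
    have hn : (0 : ℝ) ≤ n := n.cast_nonneg
    rw [hout, hout]
    · exact (le_abs_self _).trans' (by linarith)
    · exact (neg_le_abs _).trans' (by linarith)
  refine hP.lim (fun n s => AddCircle.liftIco (2 * (R + n)) (-(R + n)) f
    (s : AddCircle (2 * (R + n)))) f C ?_ hf.measurable ?_ ?_ ?_
  · exact fun n => ((hcont n).comp (AddCircle.continuous_mk' _)).measurable
  · intro n s
    exact hC _
  · intro s
    refine tendsto_const_nhds.congr' ?_
    filter_upwards [(tendsto_natCast_atTop_atTop (R := ℝ)).eventually_gt_atTop |s|] with n hn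
    rw [AddCircle.liftIco_coe_apply]
    have := abs_lt.1 hn
    constructor <;> linarith
  · exact fun n => hcirc _ (hT n).out ⟨_, hcont n⟩

end IsBoundedClosed

end BoundedBorel

/-! ### Operators determined by their quadratic forms -/

section QuadraticForm

open Filter Topology

variable {H : Type*} [NormedAddCommGroup H] [InnerProductSpace ℂ H]

/-- The polarisation identity for a form `⟨J y, A x⟩`. With `J` the inclusion of a subspace it
applies to unbounded operators `A`. -/
theorem inner_polarization {V : Type*} [AddCommGroup V] [Module ℂ V] (J A : V →ₗ[ℂ] H) (x y : V) :
    inner ℂ (J y) (A x) =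
      (inner ℂ (J (x + y)) (A (x + y)) - inner ℂ (J (x - y)) (A (x - y)) +
        Complex.I * inner ℂ (J (x + Complex.I • y)) (A (x + Complex.I • y)) -
        Complex.I * inner ℂ (J (x - Complex.I • y)) (A (x - Complex.I • y))) / 4 := by
  simp only [map_add, map_sub, inner_add_left, inner_add_right, map_smul, inner_smul_left,
    inner_smul_right, Complex.conj_I, inner_sub_left, inner_sub_right]
  linear_combination ((inner ℂ (J y) (A x) - inner ℂ (J x) (A y)) / 2) * Complex.I_sq

theorem ContinuousLinearMap.ext_inner_self {A B : H →L[ℂ] H}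
    (h : ∀ ξ, inner ℂ ξ (A ξ) = inner ℂ ξ (B ξ)) : A = B := by
  ext ξ
  refine ext_inner_left ℂ fun η => ?_
  have hA := inner_polarization (LinearMap.id : H →ₗ[ℂ] H) A ξ η
  have hB := inner_polarization (LinearMap.id : H →ₗ[ℂ] H) B ξ η
  simp only [LinearMap.id_apply, ContinuousLinearMap.coe_coe, h] at hA hB
  rw [hA, hB]

/-- An operator is bounded by twice the bound of its quadratic form. -/
theorem norm_apply_le_of_norm_inner_self_le {A : H →L[ℂ] H} {C : ℝ}
    (h : ∀ ξ, ‖inner ℂ ξ (A ξ)‖ ≤ C * ‖ξ‖ ^ 2) (ξ : H) : ‖A ξ‖ ≤ 2 * C * ‖ξ‖ := by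
  have key : ∀ x y : H, ‖inner ℂ y (A x)‖ ≤ C * (‖x‖ ^ 2 + ‖y‖ ^ 2) := by
    intro x y
    have hp := inner_polarization (LinearMap.id : H →ₗ[ℂ] H) A x y
    simp only [LinearMap.id_apply, ContinuousLinearMap.coe_coe] at hp
    have par : ∀ z : H, ‖x + z‖ ^ 2 + ‖x - z‖ ^ 2 = 2 * (‖x‖ ^ 2 + ‖z‖ ^ 2) := fun z => by
      have := parallelogram_law_with_norm ℂ x z
      nlinarith
    have hI : ‖Complex.I • y‖ = ‖y‖ := by simp [norm_smul]
    have p1 := par y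
    have p2 := par (Complex.I • y)
    rw [hI] at p2
    rw [hp, norm_div]
    have h4 : ‖(4 : ℂ)‖ = 4 := by simp
    rw [h4, div_le_iff₀ (by norm_num)]
    refine (norm_sub_le _ _).trans ((add_le_add_left ((norm_add_le _ _).trans
      (add_le_add_left (norm_sub_le _ _) _)) _).trans ?_)
    simp only [norm_mul, Complex.norm_I, one_mul]
    have e1 := h (x + y)
    have e2 := h (x - y)
    have e3 := h (x + Complex.I • y)
    have e4 := h (x - Complex.I • y)
    have q1 := congrArg (C * ·) p1
    have q2 := congrArg (C * ·) p2
    simp only [mul_add] at q1 q2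
    linarith
  rcases eq_or_ne (A ξ) 0 with h0 | h0
  · have := (norm_nonneg _).trans (key ξ 0)
    rw [h0, norm_zero]
    rcases eq_or_ne ξ 0 with h1 | h1
    · simp [h1]
    · have hpos : 0 < ‖ξ‖ := norm_pos_iff.2 h1
      have : 0 ≤ C := by
        by_contra! hc
        simp only [norm_zero] at this
        nlinarith [pow_pos hpos 2]
      positivity
  · have hξ : ξ ≠ 0 := fun h => h0 (by rw [h, map_zero])
    have hb : 0 < ‖A ξ‖ := norm_pos_iff.2 h0
    have ha : 0 < ‖ξ‖ := norm_pos_iff.2 hξ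
    -- the vector `A ξ`, rescaled to the norm of `ξ`
    have := key ξ (((‖ξ‖ / ‖A ξ‖ : ℝ) : ℂ) • A ξ)
    rw [inner_smul_left, inner_self_eq_norm_sq_to_K, norm_smul, norm_mul, RCLike.norm_conj,
      Complex.norm_real, Real.norm_of_nonneg (by positivity)] at this
    have e : ‖((‖A ξ‖ : ℂ)) ^ 2‖ = ‖A ξ‖ ^ 2 := by simp
    erw [e] at this
    have e1 : ‖ξ‖ / ‖A ξ‖ * ‖A ξ‖ ^ 2 = ‖ξ‖ * ‖A ξ‖ := by field_simp
    have e2 : ‖ξ‖ / ‖A ξ‖ * ‖A ξ‖ = ‖ξ‖ := by field_simp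
    rw [e1, e2] at this
    have : ‖ξ‖ * ‖A ξ‖ ≤ ‖ξ‖ * (2 * C * ‖ξ‖) := by nlinarith
    exact le_of_mul_le_mul_left this ha

theorem tendsto_inner_of_tendsto_inner_self {ι : Type*} {l : Filter ι} {A : ι → H →L[ℂ] H}
    {B : H →L[ℂ] H} (h : ∀ ξ, Tendsto (fun n => inner ℂ ξ (A n ξ)) l (𝓝 (inner ℂ ξ (B ξ))))
    (η ξ : H) : Tendsto (fun n => inner ℂ η (A n ξ)) l (𝓝 (inner ℂ η (B ξ))) := by
  have hp := fun A : H →L[ℂ] H => inner_polarization (LinearMap.id : H →ₗ[ℂ] H) A ξ η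
  simp only [LinearMap.id_apply, ContinuousLinearMap.coe_coe] at hp
  simp only [hp]
  exact ((((h _).sub (h _)).add ((h _).const_mul _)).sub ((h _).const_mul _)).div_const _

/-- A uniformly bounded sequence of operators whose quadratic forms converge pointwise has a weak
limit. -/
theorem exists_clm_of_tendsto_inner_self [CompleteSpace H] {A : ℕ → H →L[ℂ] H} {C : ℝ}
    (hC : ∀ n ξ, ‖inner ℂ ξ (A n ξ)‖ ≤ C * ‖ξ‖ ^ 2) {q : H → ℂ}
    (hq : ∀ ξ, Tendsto (fun n => inner ℂ ξ (A n ξ)) atTop (𝓝 (q ξ))) :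
    ∃ B : H →L[ℂ] H, ∀ ξ, inner ℂ ξ (B ξ) = q ξ := by
  have hconv : ∀ ξ η : H, ∃ b, Tendsto (fun n => inner ℂ (A n ξ) η) atTop (𝓝 b) := by
    intro ξ η
    have hp := fun n => inner_polarization (LinearMap.id : H →ₗ[ℂ] H) (A n) ξ η
    simp only [LinearMap.id_apply, ContinuousLinearMap.coe_coe] at hp
    have := (((((hq (ξ + η)).sub (hq (ξ - η))).add
      ((hq (ξ + Complex.I • η)).const_mul Complex.I)).sub
      ((hq (ξ - Complex.I • η)).const_mul Complex.I)).div_const 4)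
    simp only [← hp] at this
    refine ⟨_, ((Complex.continuous_conj.tendsto _).comp this).congr fun n => ?_⟩
    exact inner_conj_symm _ _
  choose b hb using hconv
  have hu : ∀ {u : ℕ → ℂ} {ξ η : H} {c : ℂ}, Tendsto u atTop (𝓝 c) →
      (∀ n, u n = inner ℂ (A n ξ) η) → b ξ η = c := fun h1 h2 =>
    tendsto_nhds_unique (hb _ _) (h1.congr h2)
  let B₀ : H →ₗ⋆[ℂ] H →ₗ[ℂ] ℂ := LinearMap.mk₂'ₛₗ _ _ b
    (fun x y z => hu ((hb x z).add (hb y z)) fun n => by rw [map_add, inner_add_left])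
    (fun c x z => hu ((hb x z).const_mul _) fun n => by rw [map_smul, inner_smul_left])
    (fun x y z => hu ((hb x y).add (hb x z)) fun n => by rw [inner_add_right])
    (fun c x z => hu ((hb x z).const_mul _) fun n => by
      rw [inner_smul_right]; rfl)
  let B₁ : H →L⋆[ℂ] H →L[ℂ] ℂ := B₀.mkContinuous₂ (2 * C) (by
    intro ξ η
    refine le_of_tendsto (hb ξ η).norm (Eventually.of_forall fun n => ?_)
    refine (norm_inner_le_norm _ _).trans ?_
    exact mul_le_mul_of_nonneg_right (norm_apply_le_of_norm_inner_self_le (hC n) ξ)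
      (norm_nonneg _))
  refine ⟨InnerProductSpace.continuousLinearMapOfBilin B₁, fun ξ => ?_⟩
  rw [← inner_conj_symm, InnerProductSpace.continuousLinearMapOfBilin_apply]
  have h1 : Tendsto (fun n => inner ℂ ξ (A n ξ)) atTop (𝓝 ((starRingEnd ℂ) (b ξ ξ))) :=
    ((Complex.continuous_conj.tendsto _).comp (hb ξ ξ)).congr fun n => inner_conj_symm _ _
  exact tendsto_nhds_unique h1 (hq ξ)

end QuadraticForm

/-! ### Bounded Borel functional calculi -/

section BorelCalculus

open Filter Topology

variable {H : Type*} [NormedAddCommGroup H] [InnerProductSpace ℂ H]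

/-- `Ψ` is a bounded Borel functional calculus with scalar spectral measures `μ ξ`:
it is multiplicative, and `⟨ξ, Ψ(f) ξ⟩ = ∫ f dμ_ξ` for all bounded Borel functions `f`. -/
structure IsBorelCalculus (μ : H → Measure ℝ) (Ψ : (ℝ → ℂ) → H →L[ℂ] H) : Prop where
  mass : ∀ ξ, μ ξ Set.univ = ENNReal.ofReal (‖ξ‖ ^ 2)
  inner_apply : ∀ f, IsBoundedBorel f → ∀ ξ, inner ℂ ξ (Ψ f ξ) = ∫ s, f s ∂(μ ξ)
  map_mul : ∀ f g, IsBoundedBorel f → IsBoundedBorel g → Ψ (f * g) = Ψ f * Ψ g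

theorem isFiniteMeasure_of_mass {H : Type*} [NormedAddCommGroup H] {μ : H → Measure ℝ}
    (mass : ∀ ξ, μ ξ Set.univ = ENNReal.ofReal (‖ξ‖ ^ 2)) (ξ : H) : IsFiniteMeasure (μ ξ) :=
  ⟨by rw [mass]; exact ENNReal.ofReal_lt_top⟩

theorem norm_integral_le_of_mass {H : Type*} [NormedAddCommGroup H] {μ : H → Measure ℝ}
    (mass : ∀ ξ, μ ξ Set.univ = ENNReal.ofReal (‖ξ‖ ^ 2)) {f : ℝ → ℂ} {C : ℝ}
    (hC : ∀ s, ‖f s‖ ≤ C) (ξ : H) : ‖∫ s, f s ∂(μ ξ)‖ ≤ C * ‖ξ‖ ^ 2 := by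
  have := isFiniteMeasure_of_mass mass ξ
  refine (norm_integral_le_of_norm_le_const (ae_of_all _ hC)).trans_eq ?_
  rw [Measure.real, mass, ENNReal.toReal_ofReal (by positivity)]

/-- A Borel calculus can be constructed from its values on a class of functions that generates all
bounded Borel functions under linear combinations and bounded pointwise limits. -/
theorem exists_isBorelCalculus [CompleteSpace H] {μ : H → Measure ℝ}
    (mass : ∀ ξ, μ ξ Set.univ = ENNReal.ofReal (‖ξ‖ ^ 2)) {G : Set (ℝ → ℂ)}
    (hG : ∀ f ∈ G, IsBoundedBorel f)
    (hgen : ∀ P, IsBoundedClosed P → (∀ f ∈ G, P f) → ∀ f, IsBoundedBorel f → P f)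
    (Φ : (ℝ → ℂ) → H →L[ℂ] H)
    (hΦ : ∀ f ∈ G, ∀ ξ, inner ℂ ξ (Φ f ξ) = ∫ s, f s ∂(μ ξ))
    (hmul : ∀ f ∈ G, ∀ g ∈ G, ∀ ξ, inner ℂ ξ (Φ f (Φ g ξ)) = ∫ s, (f * g) s ∂(μ ξ)) :
    ∃ Ψ, IsBorelCalculus μ Ψ := by
  have hfin := isFiniteMeasure_of_mass mass
  have hlim : ∀ (F : ℕ → ℝ → ℂ) (f : ℝ → ℂ) (C : ℝ), (∀ n, Measurable (F n)) →
      (∀ n s, ‖F n s‖ ≤ C) → (∀ s, Tendsto (fun n => F n s) atTop (𝓝 (f s))) → ∀ ξ,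
      Tendsto (fun n => ∫ s, F n s ∂(μ ξ)) atTop (𝓝 (∫ s, f s ∂(μ ξ))) :=
    fun F f C hm hC hF ξ => tendsto_integral_of_dominated_convergence (fun _ => C)
      (fun n => (hm n).aestronglyMeasurable) (integrable_const C) (fun n => ae_of_all _ (hC n))
      (ae_of_all _ hF)
  have hadd : ∀ {f g : ℝ → ℂ}, IsBoundedBorel f → IsBoundedBorel g → ∀ ξ,
      ∫ s, (f + g) s ∂(μ ξ) = ∫ s, f s ∂(μ ξ) + ∫ s, g s ∂(μ ξ) := fun hf hg ξ =>
    integral_add (hf.integrable _) (hg.integrable _)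
  have hsmul : ∀ (c : ℂ) (f : ℝ → ℂ), ∀ ξ,
      ∫ s, (c • f) s ∂(μ ξ) = c * ∫ s, f s ∂(μ ξ) := fun c f ξ => integral_smul c f
  have hex : ∀ f, IsBoundedBorel f →
      ∃ A : H →L[ℂ] H, ∀ ξ, inner ℂ ξ (A ξ) = ∫ s, f s ∂(μ ξ) := by
    refine hgen _ ⟨?_, ?_, ?_⟩ fun f hf => ⟨Φ f, hΦ f hf⟩
    · rintro f g hf hg ⟨A, hA⟩ ⟨B, hB⟩
      exact ⟨A + B, fun ξ => by rw [hadd hf hg, ← hA, ← hB, ← inner_add_right]; rfl⟩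
    · rintro c f hf ⟨A, hA⟩
      exact ⟨c • A, fun ξ => by rw [hsmul, ← hA, ← inner_smul_right]; rfl⟩
    · intro F f C hm hfm hC hF hP
      choose A hA using hP
      refine exists_clm_of_tendsto_inner_self (A := A) (C := C) (fun n ξ => ?_) fun ξ => ?_
      · rw [hA]
        exact norm_integral_le_of_mass mass (hC n) ξ
      · simp only [hA]
        exact hlim F f C hm hC hF ξ
  choose! Ψ hΨ using hex
  have hΨadd : ∀ {f g : ℝ → ℂ}, IsBoundedBorel f → IsBoundedBorel g → Ψ (f + g) = Ψ f + Ψ g :=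
    fun {f g} hf hg => ContinuousLinearMap.ext_inner_self fun ξ => by
      rw [hΨ _ (hf.add hg), hadd hf hg, add_apply, inner_add_right,
        hΨ f hf, hΨ g hg]
  have hΨsmul : ∀ (c : ℂ) {f : ℝ → ℂ}, IsBoundedBorel f → Ψ (c • f) = c • Ψ f :=
    fun c f hf => ContinuousLinearMap.ext_inner_self fun ξ => by
      rw [hΨ _ (hf.smul c), hsmul, smul_apply, inner_smul_right, hΨ f hf]
  have hΨlim : ∀ (F : ℕ → ℝ → ℂ) (f : ℝ → ℂ) (C : ℝ), (∀ n, Measurable (F n)) → Measurable f →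
      (∀ n s, ‖F n s‖ ≤ C) → (∀ s, Tendsto (fun n => F n s) atTop (𝓝 (f s))) → ∀ η ξ,
      Tendsto (fun n => inner ℂ η (Ψ (F n) ξ)) atTop (𝓝 (inner ℂ η (Ψ f ξ))) := by
    intro F f C hm hfm hC hF
    refine tendsto_inner_of_tendsto_inner_self fun ξ => ?_
    have hf : IsBoundedBorel f :=
      ⟨hfm, C, fun s => le_of_tendsto (hF s).norm (Eventually.of_forall fun n => hC n s)⟩
    simp only [hΨ f hf, fun n => hΨ (F n) ⟨hm n, C, hC n⟩]
    exact hlim F f C hm hC hF ξ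
  have hΨΦ : ∀ f ∈ G, Ψ f = Φ f := fun f hf =>
    ContinuousLinearMap.ext_inner_self fun ξ => by rw [hΨ f (hG f hf), hΦ f hf]
  -- multiplicativity extends from `G × G` one variable at a time
  have h1 : ∀ g ∈ G, ∀ f, IsBoundedBorel f → ∀ ξ,
      inner ℂ ξ (Ψ f (Ψ g ξ)) = ∫ s, (f * g) s ∂(μ ξ) := by
    intro g hg
    refine hgen _ ⟨?_, ?_, ?_⟩ fun f hf ξ => by rw [hΨΦ f hf, hΨΦ g hg, hmul f hf g hg]
    · intro f f' hf hf' h h' ξ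
      rw [add_mul, hadd (hf.mul (hG g hg)) (hf'.mul (hG g hg)), ← h, ← h', hΨadd hf hf',
        ← inner_add_right]
      rfl
    · intro c f hf h ξ
      rw [smul_mul_assoc, hsmul, ← h, hΨsmul c hf, ← inner_smul_right]
      rfl
    · intro F f C hm hfm hC hF hP ξ
      obtain ⟨B, hB⟩ := (hG g hg).2
      refine tendsto_nhds_unique (hΨlim F f C hm hfm hC hF ξ (Ψ g ξ)) ?_
      simp only [hP]
      refine hlim (fun n => F n * g) (f * g) (C * B) (fun n => (hm n).mul (hG g hg).1) ?_ ?_ ξ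
      · intro n s
        rw [Pi.mul_apply, norm_mul]
        exact mul_le_mul (hC n s) (hB s) (norm_nonneg _) ((norm_nonneg _).trans (hC n s))
      · exact fun s => (hF s).mul_const _
  have h2 : ∀ f, IsBoundedBorel f → ∀ g, IsBoundedBorel g → ∀ ξ,
      inner ℂ ξ (Ψ f (Ψ g ξ)) = ∫ s, (f * g) s ∂(μ ξ) := by
    intro f hf
    refine hgen _ ⟨?_, ?_, ?_⟩ fun g hg ξ => h1 g hg f hf ξ
    · intro g g' hg hg' h h' ξ
      rw [mul_add, hadd (hf.mul hg) (hf.mul hg'), ← h, ← h', hΨadd hg hg',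
        ← inner_add_right, ← map_add]
      rfl
    · intro c g hg h ξ
      rw [mul_smul_comm, hsmul, ← h, hΨsmul c hg, ← inner_smul_right, ← map_smul]
      rfl
    · intro F g C hm hgm hC hF hP ξ
      obtain ⟨B, hB⟩ := hf.2
      have := hΨlim F g C hm hgm hC hF (ContinuousLinearMap.adjoint (Ψ f) ξ) ξ
      simp only [ContinuousLinearMap.adjoint_inner_left, hP] at this
      refine tendsto_nhds_unique this ?_
      refine hlim (fun n => f * F n) (f * g) (B * C) (fun n => hf.1.mul (hm n)) ?_ ?_ ξ
      · intro n s
        rw [Pi.mul_apply, norm_mul]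
        exact mul_le_mul (hB s) (hC n s) (norm_nonneg _) ((norm_nonneg _).trans (hB s))
      · exact fun s => (hF s).const_mul _
  refine ⟨Ψ, mass, hΨ, fun f g hf hg => ContinuousLinearMap.ext_inner_self fun ξ => ?_⟩
  rw [hΨ _ (hf.mul hg), ← h2 f hf g hg]
  rfl

namespace IsBorelCalculus

variable {μ : H → Measure ℝ} {Ψ : (ℝ → ℂ) → H →L[ℂ] H} {f g : ℝ → ℂ}

theorem isFiniteMeasure (h : IsBorelCalculus μ Ψ) (ξ : H) : IsFiniteMeasure (μ ξ) :=
  isFiniteMeasure_of_mass h.mass ξ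

theorem map_add (h : IsBorelCalculus μ Ψ) (hf : IsBoundedBorel f) (hg : IsBoundedBorel g) :
    Ψ (f + g) = Ψ f + Ψ g := by
  refine ContinuousLinearMap.ext_inner_self fun ξ => ?_
  have := h.isFiniteMeasure ξ
  rw [h.inner_apply _ (hf.add hg), add_apply, inner_add_right,
    h.inner_apply f hf, h.inner_apply g hg]
  exact integral_add (hf.integrable _) (hg.integrable _)

theorem map_smul (h : IsBorelCalculus μ Ψ) (c : ℂ) (hf : IsBoundedBorel f) :
    Ψ (c • f) = c • Ψ f := by
  refine ContinuousLinearMap.ext_inner_self fun ξ => ?_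
  rw [h.inner_apply _ (hf.smul c), smul_apply, inner_smul_right,
    h.inner_apply f hf]
  exact integral_smul c f

theorem map_sub (h : IsBorelCalculus μ Ψ) (hf : IsBoundedBorel f) (hg : IsBoundedBorel g) :
    Ψ (f - g) = Ψ f - Ψ g := by
  refine ContinuousLinearMap.ext_inner_self fun ξ => ?_
  have := h.isFiniteMeasure ξ
  rw [h.inner_apply _ (hf.sub hg), sub_apply, inner_sub_right,
    h.inner_apply f hf, h.inner_apply g hg]
  exact integral_sub (hf.integrable _) (hg.integrable _)

theorem map_one (h : IsBorelCalculus μ Ψ) : Ψ 1 = 1 := by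
  refine ContinuousLinearMap.ext_inner_self fun ξ => ?_
  have h1 := h.inner_apply 1 (IsBoundedBorel.const 1) ξ
  have h2 : ∫ s, (1 : ℝ → ℂ) s ∂(μ ξ) = ((μ ξ).real Set.univ : ℂ) := by simp
  rw [h1, h2, Measure.real, h.mass, ENNReal.toReal_ofReal (by positivity),
    one_apply_eq_self, inner_self_eq_norm_sq_to_K]
  push_cast
  rfl

theorem map_star [CompleteSpace H] (h : IsBorelCalculus μ Ψ) (hf : IsBoundedBorel f) :
    Ψ (star f) = ContinuousLinearMap.adjoint (Ψ f) := by
  refine ContinuousLinearMap.ext_inner_self fun ξ => ?_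
  rw [h.inner_apply _ hf.star, ContinuousLinearMap.adjoint_inner_right, ← inner_conj_symm,
    h.inner_apply f hf, ← integral_conj]
  rfl

/-- For bounded `f`, the map `f ↦ Ψ(f) ξ` is isometric from `L²(μ_ξ)`, as
`⟨Ψ(f) ξ, Ψ(f) ξ⟩ = ⟨ξ, Ψ(|f|²) ξ⟩`. -/
theorem norm_sq_apply [CompleteSpace H] (h : IsBorelCalculus μ Ψ) (hf : IsBoundedBorel f) (ξ : H) :
    ‖Ψ f ξ‖ ^ 2 = ∫ s, ‖f s‖ ^ 2 ∂(μ ξ) := by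
  have h1 : inner ℂ (Ψ f ξ) (Ψ f ξ) = ∫ s, (star f * f) s ∂(μ ξ) := by
    rw [← h.inner_apply _ (hf.star.mul hf), h.map_mul _ _ hf.star hf, h.map_star hf,
      mul_apply_eq_comp, ContinuousLinearMap.adjoint_inner_right]
  have h2 : ∀ s, (star f * f) s = ((‖f s‖ ^ 2 : ℝ) : ℂ) := fun s => by
    rw [Pi.mul_apply, Pi.star_apply, RCLike.star_def, RCLike.conj_mul]
    push_cast
    rfl
  rw [inner_self_eq_norm_sq_to_K, integral_congr_ae (ae_of_all _ h2)] at h1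
  have h3 : ∫ s, ((‖f s‖ ^ 2 : ℝ) : ℂ) ∂(μ ξ) = ((∫ s, ‖f s‖ ^ 2 ∂(μ ξ) : ℝ) : ℂ) :=
    integral_ofReal
  rw [h3] at h1
  exact Complex.ofReal_injective ((Complex.ofReal_pow _ _).trans h1)

theorem norm_sub_sq [CompleteSpace H] (h : IsBorelCalculus μ Ψ) (hf : IsBoundedBorel f)
    (hg : IsBoundedBorel g) (ξ : H) : ‖Ψ f ξ - Ψ g ξ‖ ^ 2 = ∫ s, ‖f s - g s‖ ^ 2 ∂(μ ξ) := by
  have := h.norm_sq_apply (hf.sub hg) ξ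
  rwa [h.map_sub hf hg] at this

theorem norm_apply_le [CompleteSpace H] (h : IsBorelCalculus μ Ψ) (hf : Measurable f) {C : ℝ}
    (hC : ∀ s, ‖f s‖ ≤ C) (ξ : H) : ‖Ψ f ξ‖ ≤ C * ‖ξ‖ := by
  have hC0 : 0 ≤ C := (norm_nonneg _).trans (hC 0)
  have := h.isFiniteMeasure ξ
  refine abs_le_of_sq_le_sq' ?_ (by positivity) |>.2
  rw [h.norm_sq_apply ⟨hf, C, hC⟩]
  have h1 : ∀ s, ‖‖f s‖ ^ 2‖ ≤ C ^ 2 := fun s => by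
    rw [Real.norm_of_nonneg (by positivity)]
    exact pow_le_pow_left₀ (norm_nonneg _) (hC s) 2
  refine (le_abs_self _).trans ((norm_integral_le_of_norm_le_const (ae_of_all _ h1)).trans_eq ?_)
  rw [Measure.real, h.mass, ENNReal.toReal_ofReal (by positivity), mul_pow]

/-- Pointwise bounded convergence of functions implies strong convergence of operators. -/
theorem tendsto_apply [CompleteSpace H] (h : IsBorelCalculus μ Ψ) {ι : Type*} {l : Filter ι}
    [l.IsCountablyGenerated] {F : ι → ℝ → ℂ} {C : ℝ} (hF : ∀ i, Measurable (F i))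
    (hf : IsBoundedBorel f) (hC : ∀ i s, ‖F i s‖ ≤ C)
    (hlim : ∀ s, Tendsto (fun i => F i s) l (𝓝 (f s))) (ξ : H) :
    Tendsto (fun i => Ψ (F i) ξ) l (𝓝 (Ψ f ξ)) := by
  have := h.isFiniteMeasure ξ
  obtain ⟨B, hB⟩ := hf.2
  rw [tendsto_iff_norm_sub_tendsto_zero]
  have h1 : Tendsto (fun i => ‖Ψ (F i) ξ - Ψ f ξ‖ ^ 2) l (𝓝 0) := by
    simp only [fun i => h.norm_sub_sq ⟨hF i, C, hC i⟩ hf ξ]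
    have : Tendsto (fun i => ∫ s, ‖F i s - f s‖ ^ 2 ∂(μ ξ)) l (𝓝 (∫ s, (0 : ℝ) ∂(μ ξ))) := by
      refine tendsto_integral_filter_of_dominated_convergence (fun _ => (C + B) ^ 2)
        (Eventually.of_forall fun i =>
          (((hF i).sub hf.1).norm.pow_const 2).aestronglyMeasurable)
        (Eventually.of_forall fun i => ae_of_all _ fun s => ?_) (integrable_const _)
        (ae_of_all _ fun s => ?_)
      · rw [Real.norm_of_nonneg (by positivity)]
        exact pow_le_pow_left₀ (norm_nonneg _)
          ((norm_sub_le _ _).trans (add_le_add (hC i s) (hB s))) 2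
      · have := (tendsto_iff_norm_sub_tendsto_zero.1 (hlim s)).pow 2
        simpa using this
    simpa using this
  have h2 := h1.sqrt
  simpa using h2

end IsBorelCalculus

end BorelCalculus

/-! ### Projection-valued measures and Borel calculi -/

section PVM

open Filter Topology

variable {H : Type*} [NormedAddCommGroup H] [InnerProductSpace ℂ H] [CompleteSpace H]

/-- The projections `Ψ(1_Ω)` of a bounded Borel functional calculus form a projection-valued
measure. -/
theorem IsBorelCalculus.exists_projectionValuedMeasure {μ : H → Measure ℝ}
    {Ψ : (ℝ → ℂ) → H →L[ℂ] H} (h : IsBorelCalculus μ Ψ) :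
    ∃ E : ProjectionValuedMeasure H, ∀ ξ, E.measure ξ = μ ξ := by
  classical
  have hreal : ∀ Ω : Set ℝ, MeasurableSet Ω → ∀ ξ,
      inner ℂ ξ (Ψ (Ω.indicator 1) ξ) = ((μ ξ).real Ω : ℂ) := by
    intro Ω hΩ ξ
    rw [h.inner_apply _ (IsBoundedBorel.indicator hΩ), integral_indicator hΩ]
    simp
  let E : ProjectionValuedMeasure H :=
    { proj := fun Ω => if MeasurableSet Ω then Ψ (Ω.indicator 1) else 0
      isStarProjection := fun Ω hΩ => by
        have hb := IsBoundedBorel.indicator hΩ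
        rw [if_pos hΩ]
        constructor
        · rw [IsIdempotentElem, ← h.map_mul _ _ hb hb, ← Set.inter_indicator_one, Set.inter_self]
        · rw [IsSelfAdjoint, ContinuousLinearMap.star_eq_adjoint, ← h.map_star hb]
          congr 1
          ext s
          by_cases hs : s ∈ Ω <;> simp [hs]
      proj_empty := by
        rw [if_pos MeasurableSet.empty, Set.indicator_empty']
        refine ContinuousLinearMap.ext_inner_self fun ξ => ?_
        refine (h.inner_apply _ (IsBoundedBorel.const 0) ξ).trans ?_
        simp
      proj_univ := by
        rw [if_pos MeasurableSet.univ, Set.indicator_univ, h.map_one]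
      proj_inter := fun Ω₁ Ω₂ h₁ h₂ => by
        rw [if_pos h₁, if_pos h₂, if_pos (h₁.inter h₂),
          ← h.map_mul _ _ (IsBoundedBorel.indicator h₁) (IsBoundedBorel.indicator h₂),
          Set.inter_indicator_one]
      hasSum_iUnion := fun Ω hΩ hd ξ => by
        have hU := MeasurableSet.iUnion hΩ
        simp only [if_pos hU, if_pos (hΩ _)]
        have hb : ∀ S : Finset ℕ, IsBoundedBorel ((⋃ n ∈ S, Ω n).indicator 1) := fun S =>
          IsBoundedBorel.indicator (S.measurableSet_biUnion fun n _ => hΩ n)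
        have hsum : ∀ S : Finset ℕ,
            ∑ n ∈ S, Ψ ((Ω n).indicator 1) ξ = Ψ ((⋃ n ∈ S, Ω n).indicator 1) ξ := by
          intro S
          induction S using Finset.induction_on with
          | empty =>
            have h0 := h.map_smul 0 (IsBoundedBorel.const 1)
            rw [zero_smul, zero_smul] at h0
            simp only [Finset.sum_empty, Finset.notMem_empty, Set.iUnion_of_empty,
              Set.iUnion_empty, Set.indicator_empty']
            exact (DFunLike.congr_fun h0 ξ).symm
          | insert a S ha ih =>
            rw [Finset.sum_insert ha, ih, Finset.set_biUnion_insert,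
              Set.indicator_union_of_disjoint]
            · exact (DFunLike.congr_fun
                (h.map_add (IsBoundedBorel.indicator (hΩ a)) (hb S)) ξ).symm
            · rw [Set.disjoint_iUnion₂_right]
              exact fun n hn => hd fun hne => ha (hne ▸ hn)
        rw [HasSum]
        simp only [SummationFilter.unconditional_filter, hsum]
        refine h.tendsto_apply (C := 1) (fun S => (hb S).1) (IsBoundedBorel.indicator hU)
          (fun S s => ?_) (fun s => ?_) ξ
        · by_cases hs : s ∈ ⋃ n ∈ S, Ω n <;> simp [hs]
        · refine tendsto_const_nhds.congr' ?_
          by_cases hs : ∃ n, s ∈ Ω n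
          · obtain ⟨n, hn⟩ := hs
            filter_upwards [eventually_ge_atTop {n}] with S hS
            rw [Set.indicator_of_mem (Set.mem_iUnion.2 ⟨n, hn⟩), Set.indicator_of_mem
              (Set.mem_iUnion₂.2 ⟨n, hS (Finset.mem_singleton_self n), hn⟩)]
          · refine Eventually.of_forall fun S => ?_
            push Not at hs
            have h1 : s ∉ ⋃ n, Ω n := by simpa using hs
            have h2 : s ∉ ⋃ n ∈ S, Ω n := by simpa using fun i _ => hs i
            simp only [Set.indicator_of_notMem h1, Set.indicator_of_notMem h2]
      proj_of_not_measurable := fun Ω hΩ => if_neg hΩ }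
  refine ⟨E, fun ξ => Measure.ext fun Ω hΩ => ?_⟩
  have := h.isFiniteMeasure ξ
  rw [ProjectionValuedMeasure.measure, Measure.ofMeasurable_apply _ hΩ]
  simp only [E, if_pos hΩ, hreal Ω hΩ, Complex.ofReal_re]
  exact ofReal_measureReal

namespace ProjectionValuedMeasure

variable (E : ProjectionValuedMeasure H)

theorem measure_apply (ξ : H) {Ω : Set ℝ} (hΩ : MeasurableSet Ω) :
    E.measure ξ Ω = ENNReal.ofReal (inner ℂ ξ (E.proj Ω ξ)).re :=
  Measure.ofMeasurable_apply _ hΩ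

theorem inner_proj (ξ : H) {Ω : Set ℝ} (hΩ : MeasurableSet Ω) :
    inner ℂ ξ (E.proj Ω ξ) = ∫ s, Ω.indicator (1 : ℝ → ℂ) s ∂(E.measure ξ) := by
  rw [integral_indicator hΩ]
  have h : ((inner ℂ ξ (E.proj Ω ξ)).re : ℂ) = inner ℂ ξ (E.proj Ω ξ) := by
    rw [← Complex.conj_eq_iff_re, inner_conj_symm, ← ContinuousLinearMap.adjoint_inner_right,
      ← ContinuousLinearMap.star_eq_adjoint, (E.isStarProjection Ω hΩ).isSelfAdjoint.star_eq]
  rw [← h]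
  simp [Measure.real, E.measure_apply ξ hΩ, E.re_inner_proj_nonneg ξ hΩ]

theorem exists_isBorelCalculus : ∃ Ψ, IsBorelCalculus E.measure Ψ := by
  classical
  -- an indicator function determines its set as its support
  let Φ : (ℝ → ℂ) → H →L[ℂ] H := fun f => E.proj (Function.support f)
  have hΦ : ∀ Ω : Set ℝ, Φ (Ω.indicator 1) = E.proj Ω := fun Ω => by
    simp only [Φ]
    congr 1
    ext s
    simp
  refine _root_.exists_isBorelCalculus (G := {f | ∃ Ω, MeasurableSet Ω ∧ f = Ω.indicator 1})
    (fun ξ => ?_) ?_ ?_ Φ ?_ ?_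
  · rw [E.measure_apply ξ MeasurableSet.univ, E.proj_univ, one_apply_eq_self,
      inner_self_eq_norm_sq_to_K]
    norm_cast
  · rintro _ ⟨Ω, hΩ, rfl⟩
    exact IsBoundedBorel.indicator hΩ
  · exact fun P hP hG f hf => hP.of_indicator (fun Ω hΩ => hG _ ⟨Ω, hΩ, rfl⟩) f hf
  · rintro _ ⟨Ω, hΩ, rfl⟩ ξ
    rw [hΦ, E.inner_proj ξ hΩ]
  · rintro _ ⟨Ω, hΩ, rfl⟩ _ ⟨Ω', hΩ', rfl⟩ ξ
    rw [hΦ, hΦ, ← Set.inter_indicator_one, ← E.inner_proj ξ (hΩ.inter hΩ'),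
      E.proj_inter _ _ hΩ hΩ', mul_apply_eq_comp]

/-- The bounded operators `∫ f dE`, for bounded Borel functions `f`. -/
noncomputable def bounded (f : ℝ → ℂ) : H →L[ℂ] H := E.exists_isBorelCalculus.choose f

theorem isBorelCalculus : IsBorelCalculus E.measure E.bounded :=
  E.exists_isBorelCalculus.choose_spec

instance (ξ : H) : IsFiniteMeasure (E.measure ξ) := E.isBorelCalculus.isFiniteMeasure ξ

theorem bounded_indicator {Ω : Set ℝ} (hΩ : MeasurableSet Ω) :
    E.bounded (Ω.indicator 1) = E.proj Ω :=
  ContinuousLinearMap.ext_inner_self fun ξ => by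
    rw [E.isBorelCalculus.inner_apply _ (IsBoundedBorel.indicator hΩ), E.inner_proj ξ hΩ]

end ProjectionValuedMeasure

end PVM

/-! ### Unbounded integrals against a projection-valued measure -/

section UnboundedIntegral

open Filter Topology

/-- The bounded function which agrees with `f` where `‖f‖ ≤ n` and vanishes elsewhere. -/
noncomputable def truncate (f : ℝ → ℂ) (n : ℕ) : ℝ → ℂ := {s | ‖f s‖ ≤ n}.indicator f

theorem norm_truncate_le (f : ℝ → ℂ) (n : ℕ) (s : ℝ) : ‖truncate f n s‖ ≤ n := by
  by_cases h : ‖f s‖ ≤ n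
  · rwa [truncate, Set.indicator_of_mem (show s ∈ {s | ‖f s‖ ≤ n} from h)]
  · rw [truncate, Set.indicator_of_notMem (show s ∉ {s | ‖f s‖ ≤ n} from h), norm_zero]
    positivity

theorem norm_truncate_le_norm (f : ℝ → ℂ) (n : ℕ) (s : ℝ) : ‖truncate f n s‖ ≤ ‖f s‖ :=
  norm_indicator_le_norm_self _ _

theorem measurableSet_norm_le {f : ℝ → ℂ} (hf : Measurable f) (n : ℕ) :
    MeasurableSet {s | ‖f s‖ ≤ n} :=
  measurableSet_le hf.norm measurable_const

theorem measurable_truncate {f : ℝ → ℂ} (hf : Measurable f) (n : ℕ) :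
    Measurable (truncate f n) :=
  hf.indicator (measurableSet_norm_le hf n)

theorem IsBoundedBorel.truncate {f : ℝ → ℂ} (hf : Measurable f) (n : ℕ) :
    IsBoundedBorel (truncate f n) :=
  ⟨measurable_truncate hf n, n, norm_truncate_le f n⟩

theorem truncate_eventually_eq (f : ℝ → ℂ) (s : ℝ) :
    ∀ᶠ n in atTop, truncate f n s = f s := by
  filter_upwards [(tendsto_natCast_atTop_atTop (R := ℝ)).eventually_ge_atTop ‖f s‖] with n hn
  exact Set.indicator_of_mem (show s ∈ {s | ‖f s‖ ≤ n} from hn) f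

theorem tendsto_truncate (f : ℝ → ℂ) (s : ℝ) :
    Tendsto (fun n => truncate f n s) atTop (𝓝 (f s)) :=
  tendsto_const_nhds.congr' ((truncate_eventually_eq f s).mono fun _ h => h.symm)

theorem norm_truncate_sub_truncate_le (f : ℝ → ℂ) {m n : ℕ} (hmn : m ≤ n) (s : ℝ) :
    ‖truncate f m s - truncate f n s‖ ≤ ‖truncate f m s - f s‖ := by
  have hmn' : (m : ℝ) ≤ n := by exact_mod_cast hmn
  by_cases h1 : ‖f s‖ ≤ m
  · have h2 : ‖f s‖ ≤ n := h1.trans hmn'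
    simp [truncate, Set.indicator, h1, h2]
  · by_cases h2 : ‖f s‖ ≤ n <;> simp [truncate, Set.indicator, h1, h2]

variable {H : Type*} [NormedAddCommGroup H] [InnerProductSpace ℂ H] [CompleteSpace H]

namespace ProjectionValuedMeasure

variable (E : ProjectionValuedMeasure H) {f g : ℝ → ℂ}

theorem eLpNorm_eq_norm_bounded (hf : IsBoundedBorel f) (ξ : H) :
    eLpNorm f 2 (E.measure ξ) = ENNReal.ofReal ‖E.bounded f ξ‖ := by
  have hmem : MemLp f 2 (E.measure ξ) := by
    obtain ⟨C, hC⟩ := hf.2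
    exact MemLp.of_bound hf.1.aestronglyMeasurable C (ae_of_all _ hC)
  rw [hmem.eLpNorm_eq_integral_rpow_norm two_ne_zero ENNReal.ofNat_ne_top]
  congr 1
  have h1 : ∫ s, ‖f s‖ ^ (2 : ENNReal).toReal ∂(E.measure ξ) = ‖E.bounded f ξ‖ ^ 2 := by
    rw [E.isBorelCalculus.norm_sq_apply hf]
    refine integral_congr_ae (ae_of_all _ fun s => ?_)
    simp
  rw [h1]
  rw [ENNReal.toReal_ofNat, ← one_div, ← Real.sqrt_eq_rpow, Real.sqrt_sq (norm_nonneg _)]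

theorem integrable_norm_sub_sq (hf : Measurable f) (hg : IsBoundedBorel g) {ξ : H}
    (hξ : MemLp f 2 (E.measure ξ)) : Integrable (fun s => ‖g s - f s‖ ^ 2) (E.measure ξ) := by
  obtain ⟨C, hC⟩ := hg.2
  have hmem : MemLp g 2 (E.measure ξ) :=
    MemLp.of_bound hg.1.aestronglyMeasurable C (ae_of_all _ hC)
  exact (memLp_two_iff_integrable_sq_norm (hg.1.sub hf).aestronglyMeasurable).1 (hmem.sub hξ)

theorem tendsto_integral_norm_truncate_sub_sq (hf : Measurable f) {ξ : H}
    (hξ : MemLp f 2 (E.measure ξ)) {g : ℝ → ℂ} (hg : IsBoundedBorel g) :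
    Tendsto (fun n => ∫ s, ‖g s - truncate f n s‖ ^ 2 ∂(E.measure ξ)) atTop
      (𝓝 (∫ s, ‖g s - f s‖ ^ 2 ∂(E.measure ξ))) := by
  obtain ⟨C, hC⟩ := hg.2
  have hint := (memLp_two_iff_integrable_sq_norm hf.aestronglyMeasurable).1 hξ
  have hdom : Integrable (fun s => 2 * (C ^ 2 + ‖f s‖ ^ 2)) (E.measure ξ) :=
    Integrable.const_mul ((integrable_const (C ^ 2)).add hint) 2
  refine tendsto_integral_of_dominated_convergence _
    (fun n => ((hg.1.sub (measurable_truncate hf n)).norm.pow_const 2).aestronglyMeasurable)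
    hdom (fun n => ae_of_all _ fun s => ?_) (ae_of_all _ fun s => ?_)
  · rw [Real.norm_of_nonneg (by positivity)]
    have h1 := (norm_sub_le (g s) (truncate f n s)).trans
      (add_le_add (hC s) (norm_truncate_le_norm f n s))
    refine (pow_le_pow_left₀ (norm_nonneg _) h1 2).trans ?_
    linarith [sq_nonneg (C - ‖f s‖)]
  · exact ((tendsto_const_nhds.sub (tendsto_truncate f s)).norm.pow 2)

/-- The domain of `∫ f dE` consists of the vectors on which the truncated integrals converge. -/
theorem memLp_iff_exists_tendsto (hf : Measurable f) (ξ : H) :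
    MemLp f 2 (E.measure ξ) ↔
      ∃ y, Tendsto (fun n => E.bounded (truncate f n) ξ) atTop (𝓝 y) := by
  constructor
  · intro hξ
    refine cauchySeq_tendsto_of_complete (cauchySeq_of_le_tendsto_0'
      (fun n => √(∫ s, ‖truncate f n s - f s‖ ^ 2 ∂(E.measure ξ))) (fun m n hmn => ?_) ?_)
    · refine Real.le_sqrt_of_sq_le ?_
      rw [dist_eq_norm, E.isBorelCalculus.norm_sub_sq (IsBoundedBorel.truncate hf m)
        (IsBoundedBorel.truncate hf n)]
      refine integral_mono_of_nonneg (ae_of_all _ fun s => by positivity)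
        (E.integrable_norm_sub_sq hf (IsBoundedBorel.truncate hf m) hξ) (ae_of_all _ fun s => ?_)
      exact pow_le_pow_left₀ (norm_nonneg _) (norm_truncate_sub_truncate_le f hmn s) 2
    · have hint := (memLp_two_iff_integrable_sq_norm hf.aestronglyMeasurable).1 hξ
      have : Tendsto (fun n => ∫ s, ‖truncate f n s - f s‖ ^ 2 ∂(E.measure ξ)) atTop
          (𝓝 (∫ s, (0 : ℝ) ∂(E.measure ξ))) := by
        refine tendsto_integral_of_dominated_convergence (fun s => ‖f s‖ ^ 2)
          (fun n => (((measurable_truncate hf n).sub hf).norm.pow_const 2).aestronglyMeasurable)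
          hint (fun n => ae_of_all _ fun s => ?_) (ae_of_all _ fun s => ?_)
        · rw [Real.norm_of_nonneg (by positivity)]
          refine pow_le_pow_left₀ (norm_nonneg _) ?_ 2
          by_cases h : ‖f s‖ ≤ n <;> simp [truncate, Set.indicator, h]
        · have := (tendsto_iff_norm_sub_tendsto_zero.1 (tendsto_truncate f s)).pow 2
          simpa using this
      rw [integral_zero] at this
      simpa using this.sqrt
  · rintro ⟨y, hy⟩
    refine ⟨hf.aestronglyMeasurable, ?_⟩
    have h1 := Lp.eLpNorm_lim_le_liminf_eLpNorm (p := 2) (μ := E.measure ξ)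
      (f := fun n => truncate f n) (fun n => (measurable_truncate hf n).aestronglyMeasurable) f
      (ae_of_all _ fun s => tendsto_truncate f s)
    simp only [fun n => E.eLpNorm_eq_norm_bounded (IsBoundedBorel.truncate hf n) ξ] at h1
    rw [(ENNReal.tendsto_ofReal hy.norm).liminf_eq] at h1
    exact h1.trans_lt ENNReal.ofReal_lt_top

/-- If the truncated integrals are bounded on `ξ`, then `ξ` is in the domain of `∫ f dE`. -/
theorem memLp_of_norm_bounded_le (hf : Measurable f) {ξ : H} {C : ℝ}
    (hC : ∀ n, ‖E.bounded (truncate f n) ξ‖ ≤ C) : MemLp f 2 (E.measure ξ) := by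
  refine ⟨hf.aestronglyMeasurable, ?_⟩
  have h1 := Lp.eLpNorm_lim_le_liminf_eLpNorm (p := 2) (μ := E.measure ξ)
    (f := fun n => truncate f n) (fun n => (measurable_truncate hf n).aestronglyMeasurable) f
    (ae_of_all _ fun s => tendsto_truncate f s)
  simp only [fun n => E.eLpNorm_eq_norm_bounded (IsBoundedBorel.truncate hf n) ξ] at h1
  refine (h1.trans (liminf_le_of_frequently_le' (x := ENNReal.ofReal C)
    (Frequently.of_forall fun n => ENNReal.ofReal_le_ofReal (hC n)))).trans_lt
    ENNReal.ofReal_lt_top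

/-- The operator `∫ f dE` exists, as the strong limit of the truncated integrals on the vectors
where it exists. -/
theorem exists_isIntegral_tendsto (hf : Measurable f) : ∃ A : H →ₗ.[ℂ] H, E.IsIntegral f A ∧
    ∀ ξ : A.domain, Tendsto (fun n => E.bounded (truncate f n) ξ) atTop (𝓝 (A ξ)) := by
  let D : Submodule ℂ H :=
    { carrier := {ξ | ∃ y, Tendsto (fun n => E.bounded (truncate f n) ξ) atTop (𝓝 y)}
      add_mem' := by
        rintro ξ η ⟨y, hy⟩ ⟨z, hz⟩
        exact ⟨y + z, by simpa only [map_add] using hy.add hz⟩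
      zero_mem' := ⟨0, by simpa only [map_zero] using tendsto_const_nhds⟩
      smul_mem' := by
        rintro c ξ ⟨y, hy⟩
        exact ⟨c • y, by simpa only [map_smul] using hy.const_smul c⟩ }
  choose a ha using fun ξ : D => ξ.2
  let A : H →ₗ.[ℂ] H :=
    { domain := D
      toFun :=
        { toFun := a
          map_add' := fun ξ η => tendsto_nhds_unique (ha (ξ + η)) (by
            simpa only [Submodule.coe_add, map_add] using (ha ξ).add (ha η))
          map_smul' := fun c ξ => tendsto_nhds_unique (ha (c • ξ)) (by
            simpa only [Submodule.coe_smul, map_smul, RingHom.id_apply] using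
              (ha ξ).const_smul c) } }
  refine ⟨A, ⟨fun ξ => (E.memLp_iff_exists_tendsto hf ξ).symm, fun ξ => ?_⟩, ha⟩
  have hξ : MemLp f 2 (E.measure (ξ : H)) := (E.memLp_iff_exists_tendsto hf ξ).2 ξ.2
  have h1 : Tendsto (fun n => inner ℂ (ξ : H) (E.bounded (truncate f n) ξ)) atTop
      (𝓝 (inner ℂ (ξ : H) (A ξ))) := tendsto_const_nhds.inner (ha ξ)
  refine tendsto_nhds_unique h1 ?_
  simp only [fun n => E.isBorelCalculus.inner_apply _ (IsBoundedBorel.truncate hf n)]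
  exact tendsto_integral_of_dominated_convergence (fun s => ‖f s‖)
    (fun n => (measurable_truncate hf n).aestronglyMeasurable)
    (hξ.integrable (by norm_num)).norm
    (fun n => ae_of_all _ (norm_truncate_le_norm f n)) (ae_of_all _ (tendsto_truncate f))

theorem isIntegral_integral (hf : Measurable f) : E.IsIntegral f (E.integral f) :=
  Classical.epsilon_spec ((E.exists_isIntegral_tendsto hf).imp fun _ h => h.1)

/-- `∫ g dE` maps into the domain of `∫ f dE` when `f * g` is bounded. -/
theorem memLp_bounded_apply (hf : Measurable f) (hg : IsBoundedBorel g)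
    (hfg : IsBoundedBorel (f * g)) (ξ : H) : MemLp f 2 (E.measure (E.bounded g ξ)) := by
  obtain ⟨C, hC⟩ := hfg.2
  refine E.memLp_of_norm_bounded_le hf (C := C * ‖ξ‖) fun n => ?_
  rw [← mul_apply_eq_comp, ← E.isBorelCalculus.map_mul _ _ (IsBoundedBorel.truncate hf n) hg]
  refine E.isBorelCalculus.norm_apply_le ((measurable_truncate hf n).mul hg.1) (fun s => ?_) ξ
  rw [Pi.mul_apply, norm_mul]
  refine le_trans ?_ (hC s)
  rw [Pi.mul_apply, norm_mul]
  exact mul_le_mul_of_nonneg_right (norm_truncate_le_norm f n s) (norm_nonneg _)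

/-- The domain of `∫ f dE` is dense: it contains the ranges of `E {‖f‖ ≤ n}`. -/
theorem dense_memLp (hf : Measurable f) : Dense {ξ | MemLp f 2 (E.measure ξ)} := by
  intro ξ
  have hb : ∀ n : ℕ, IsBoundedBorel ({s | ‖f s‖ ≤ n}.indicator 1) := fun n =>
    IsBoundedBorel.indicator (measurableSet_norm_le hf n)
  refine mem_closure_of_tendsto (f := fun n : ℕ => E.bounded ({s | ‖f s‖ ≤ n}.indicator 1) ξ)
    (b := atTop) ?_ (Eventually.of_forall fun n => E.memLp_bounded_apply hf (hb n) ?_ ξ)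
  · have := E.isBorelCalculus.tendsto_apply (l := atTop) (C := 1)
      (F := fun n : ℕ => {s | ‖f s‖ ≤ n}.indicator 1) (f := 1) (fun n => (hb n).1)
      (IsBoundedBorel.const 1) (fun n s => ?_) (fun s => ?_) ξ
    · rwa [E.isBorelCalculus.map_one] at this
    · by_cases hs : ‖f s‖ ≤ n <;> simp [Set.indicator, hs]
    · refine tendsto_const_nhds.congr' ?_
      filter_upwards [(tendsto_natCast_atTop_atTop (R := ℝ)).eventually_ge_atTop ‖f s‖] with n hn
      simp [Set.indicator, hn]
  · have : f * {s | ‖f s‖ ≤ n}.indicator 1 = truncate f n := by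
      ext s
      by_cases hs : ‖f s‖ ≤ n <;> simp [truncate, Set.indicator, hs]
    rw [this]
    exact IsBoundedBorel.truncate hf n

namespace IsIntegral

variable {E} {A B : H →ₗ.[ℂ] H}

theorem dense_domain (hf : Measurable f) (hA : E.IsIntegral f A) :
    Dense (A.domain : Set H) := by
  have := E.dense_memLp hf
  simp only [← hA.mem_domain_iff] at this
  exact this

/-- By density of the domain and polarisation, `∫ f dE` is unique. This makes the value of
`ProjectionValuedMeasure.integral` independent of choices. -/
theorem unique (hf : Measurable f) (hA : E.IsIntegral f A) (hB : E.IsIntegral f B) : A = B := by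
  have hdom : A.domain = B.domain := by
    ext ξ
    rw [hA.mem_domain_iff, hB.mem_domain_iff]
  refine LinearPMap.ext hdom fun ξ hξA hξB => ?_
  have hd := hA.dense_domain hf
  let B' : A.domain →ₗ[ℂ] H := B.toFun.comp (Submodule.inclusion hdom.le)
  refine hd.eq_of_inner_left ℂ fun η hη => ?_
  have h1 := inner_polarization A.domain.subtype A.toFun ⟨ξ, hξA⟩ ⟨η, hη⟩
  have h2 := inner_polarization A.domain.subtype B' ⟨ξ, hξA⟩ ⟨η, hη⟩
  have hq : ∀ ζ : A.domain, inner ℂ (A.domain.subtype ζ) (A.toFun ζ) =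
      inner ℂ (A.domain.subtype ζ) (B' ζ) := fun ζ =>
    (hA.inner_apply ζ).trans (hB.inner_apply (Submodule.inclusion hdom.le ζ)).symm
  rw [hq, hq, hq, hq, ← h2] at h1
  have h3 := congrArg (starRingEnd ℂ) h1
  rw [inner_conj_symm, inner_conj_symm] at h3
  exact h3

theorem eq_integral (hf : Measurable f) (hA : E.IsIntegral f A) : A = E.integral f :=
  hA.unique hf (E.isIntegral_integral hf)

theorem tendsto_truncate (hf : Measurable f) (hA : E.IsIntegral f A) (ξ : A.domain) :
    Tendsto (fun n => E.bounded (truncate f n) ξ) atTop (𝓝 (A ξ)) := by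
  obtain ⟨B, hB, hlim⟩ := E.exists_isIntegral_tendsto hf
  obtain rfl := hA.unique hf hB
  exact hlim ξ

/-- The `L²` isometry, for the difference of a bounded and an unbounded integral. -/
theorem norm_bounded_sub_sq (hf : Measurable f) (hA : E.IsIntegral f A) (ξ : A.domain)
    (hg : IsBoundedBorel g) :
    ‖E.bounded g ξ - A ξ‖ ^ 2 = ∫ s, ‖g s - f s‖ ^ 2 ∂(E.measure (ξ : H)) := by
  refine tendsto_nhds_unique
    ((tendsto_const_nhds.sub (hA.tendsto_truncate hf ξ)).norm.pow 2) ?_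
  simp only [fun n => E.isBorelCalculus.norm_sub_sq hg (IsBoundedBorel.truncate hf n)]
  exact E.tendsto_integral_norm_truncate_sub_sq hf ((hA.mem_domain_iff _).1 ξ.2) hg

theorem exists_apply_bounded (hf : Measurable f) (hA : E.IsIntegral f A) (hg : IsBoundedBorel g)
    (hfg : IsBoundedBorel (f * g)) (ξ : H) :
    ∃ h : E.bounded g ξ ∈ A.domain, A ⟨E.bounded g ξ, h⟩ = E.bounded (f * g) ξ := by
  have h := (hA.mem_domain_iff _).2 (E.memLp_bounded_apply hf hg hfg ξ)
  refine ⟨h, tendsto_nhds_unique (hA.tendsto_truncate hf ⟨_, h⟩) ?_⟩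
  simp only [← mul_apply_eq_comp,
    fun n => (E.isBorelCalculus.map_mul _ _ (IsBoundedBorel.truncate hf n) hg).symm]
  obtain ⟨C, hC⟩ := hfg.2
  refine E.isBorelCalculus.tendsto_apply (C := C)
    (fun n => (measurable_truncate hf n).mul hg.1) hfg (fun n s => ?_)
    (fun s => (_root_.tendsto_truncate f s).mul_const _) ξ
  refine le_trans ?_ (hC s)
  rw [Pi.mul_apply, Pi.mul_apply, norm_mul, norm_mul]
  exact mul_le_mul_of_nonneg_right (norm_truncate_le_norm f n s) (norm_nonneg _)

end IsIntegral

theorem isIntegral_bounded (hf : IsBoundedBorel f) :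
    E.IsIntegral f ((E.bounded f : H →ₗ[ℂ] H).toPMap ⊤) := by
  refine ⟨fun ξ => iff_of_true trivial ?_, fun ξ => E.isBorelCalculus.inner_apply f hf ξ⟩
  obtain ⟨C, hC⟩ := hf.2
  exact MemLp.of_bound hf.1.aestronglyMeasurable C (ae_of_all _ hC)

theorem integral_eq_bounded (hf : IsBoundedBorel f) :
    E.integral f = (E.bounded f : H →ₗ[ℂ] H).toPMap ⊤ :=
  ((E.isIntegral_bounded hf).eq_integral hf.1).symm

end ProjectionValuedMeasure

end UnboundedIntegral

/-! ### Self-adjoint operators and their resolvents -/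

section Resolvent

open Filter Topology

variable {H : Type*} [NormedAddCommGroup H] [InnerProductSpace ℂ H] {T : H →ₗ.[ℂ] H}

/-- For a symmetric operator, `‖(T + ic) x‖² = ‖T x‖² + c² ‖x‖²`. -/
theorem LinearPMap.norm_add_smul_I_sq (hT : ∀ x y : T.domain, inner ℂ (T x) (y : H) =
    inner ℂ (x : H) (T y)) (c : ℝ) (x : T.domain) :
    ‖T x + (c * Complex.I) • (x : H)‖ ^ 2 = ‖T x‖ ^ 2 + c ^ 2 * ‖(x : H)‖ ^ 2 := by
  have hre : (inner ℂ (T x) (x : H)).im = 0 := by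
    rw [← Complex.conj_eq_iff_im, inner_conj_symm, hT x x]
  rw [@norm_add_sq ℂ, inner_smul_right, norm_smul, mul_pow]
  have h1 : RCLike.re ((c * Complex.I) * inner ℂ (T x) (x : H)) = 0 := by
    simp [hre]
  rw [h1]
  simp

theorem LinearPMap.eq_zero_of_apply_add_smul_I_eq_zero (hT : ∀ x y : T.domain,
    inner ℂ (T x) (y : H) = inner ℂ (x : H) (T y)) {c : ℝ} (hc : c ≠ 0) {x : T.domain}
    (h : T x + (c * Complex.I) • (x : H) = 0) : (x : H) = 0 := by
  have h1 := LinearPMap.norm_add_smul_I_sq hT c x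
  rw [h, norm_zero] at h1
  have h2 : c ^ 2 * ‖(x : H)‖ ^ 2 = 0 := by nlinarith [sq_nonneg ‖T x‖, sq_nonneg (c * ‖(x : H)‖)]
  rcases mul_eq_zero.1 h2 with h3 | h3
  · exact absurd (pow_eq_zero_iff two_ne_zero |>.1 h3) hc
  · exact norm_eq_zero.1 (pow_eq_zero_iff two_ne_zero |>.1 h3)

variable [CompleteSpace H]

theorem LinearPMap.inner_apply_eq_of_isSelfAdjoint (hT : IsSelfAdjoint T) (x y : T.domain) :
    inner ℂ (T x) (y : H) = inner ℂ (x : H) (T y) := by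
  have h := LinearPMap.adjoint_isFormalAdjoint hT.dense_domain
  rw [LinearPMap.isSelfAdjoint_def.1 hT] at h
  exact h x y

/-- The domain of a self-adjoint operator contains that of its adjoint. -/
theorem LinearPMap.exists_apply_eq_of_isSelfAdjoint (hT : IsSelfAdjoint T) {y w : H}
    (h : ∀ x : T.domain, inner ℂ w (x : H) = inner ℂ y (T x)) :
    ∃ hy : y ∈ T.domain, T ⟨y, hy⟩ = w := by
  have key : ∀ S : H →ₗ.[ℂ] H, LinearPMap.adjoint T = S → ∃ hy : y ∈ S.domain, S ⟨y, hy⟩ = w := by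
    rintro S rfl
    exact ⟨LinearPMap.mem_adjoint_domain_of_exists y ⟨w, h⟩,
      LinearPMap.adjoint_apply_eq hT.dense_domain _ h⟩
  exact key T (LinearPMap.isSelfAdjoint_def.1 hT)

/-- For a self-adjoint operator `T` and a real number `c` of modulus one, `T + ic` is onto. -/
theorem LinearPMap.exists_apply_add_smul_I_eq (hT : IsSelfAdjoint T) {c : ℝ} (hc : c ^ 2 = 1)
    (y : H) : ∃ x : T.domain, T x + (c * Complex.I) • (x : H) = y := by
  let S : T.domain →ₗ[ℂ] H := T.toFun + (c * Complex.I) • T.domain.subtype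
  have hS : ∀ x, S x = T x + (c * Complex.I) • (x : H) := fun x => rfl
  have hsymm := LinearPMap.inner_apply_eq_of_isSelfAdjoint hT
  have hnorm : ∀ x : T.domain, ‖(x : H)‖ ≤ ‖S x‖ := by
    intro x
    refine abs_le_of_sq_le_sq' ?_ (norm_nonneg _) |>.2
    rw [hS, LinearPMap.norm_add_smul_I_sq hsymm, hc]
    nlinarith [sq_nonneg ‖T x‖]
  -- `S = T + ic` is bounded below and closed, so its range is closed
  have hclosed : _root_.IsClosed (LinearMap.range S : Set H) := by
    refine IsSeqClosed.isClosed fun u z hu hz => ?_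
    choose v hv using hu
    have hcs : CauchySeq fun n => (v n : H) := by
      have hu' := hz.cauchySeq
      rw [Metric.cauchySeq_iff] at hu' ⊢
      intro ε hε
      obtain ⟨N, hN⟩ := hu' ε hε
      refine ⟨N, fun m hm n hn => lt_of_le_of_lt ?_ (hN m hm n hn)⟩
      have := hnorm (v m - v n)
      rw [_root_.map_sub, hv, hv] at this
      rwa [dist_eq_norm, dist_eq_norm]
    obtain ⟨x, hx⟩ := cauchySeq_tendsto_of_complete hcs
    have hTv : Tendsto (fun n => T (v n)) atTop (𝓝 (z - (c * Complex.I) • x)) := by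
      refine (hz.sub (hx.const_smul (c * Complex.I))).congr fun n => ?_
      rw [← hv, hS, add_sub_cancel_right]
    have hmem : (x, z - (c * Complex.I) • x) ∈ T.graph :=
      _root_.IsClosed.mem_of_tendsto (hT.isClosed : _root_.IsClosed (T.graph : Set (H × H)))
        (hx.prodMk_nhds hTv) (Eventually.of_forall fun n => LinearPMap.mem_graph T (v n))
    obtain ⟨x', hx', hTx'⟩ := (LinearPMap.mem_graph_iff T).1 hmem
    refine ⟨x', ?_⟩
    rw [hS, hTx', hx']
    exact sub_add_cancel _ _
  -- a vector orthogonal to the range lies in the kernel of `T - ic`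
  have hbot : (LinearMap.range S)ᗮ = ⊥ := by
    rw [Submodule.eq_bot_iff]
    intro w hw
    have h1 : ∀ x : T.domain, inner ℂ ((c * Complex.I) • w) (x : H) = inner ℂ w (T x) := by
      intro x
      have := (Submodule.mem_orthogonal' _ _).1 hw (S x) ⟨x, rfl⟩
      rw [hS, inner_add_right, inner_smul_right] at this
      rw [inner_smul_left, map_mul, Complex.conj_ofReal, Complex.conj_I]
      linear_combination -this
    obtain ⟨hwm, hTw⟩ := LinearPMap.exists_apply_eq_of_isSelfAdjoint hT h1
    have h2 := LinearPMap.norm_add_smul_I_sq hsymm (-c) ⟨w, hwm⟩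
    rw [hTw] at h2
    have h3 : (c * Complex.I) • w + (((-c : ℝ) : ℂ) * Complex.I) • w = 0 := by
      rw [← add_smul]
      simp
    rw [h3, norm_smul] at h2
    have hcn : ‖(c : ℂ) * Complex.I‖ ^ 2 = 1 := by simp [hc]
    rw [mul_pow, hcn, norm_zero] at h2
    have : ‖w‖ = 0 := by
      have h4 : ‖w‖ ^ 2 = 0 := by
        rw [neg_sq, hc] at h2
        linarith
      exact pow_eq_zero_iff two_ne_zero |>.1 h4
    exact norm_eq_zero.1 this
  have htop : LinearMap.range S = ⊤ := by
    have : CompleteSpace (LinearMap.range S) := hclosed.completeSpace_coe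
    exact (Submodule.orthogonal_eq_bot_iff).1 hbot
  exact LinearMap.range_eq_top.1 htop y

/-- A self-adjoint operator has no proper symmetric extension. -/
theorem LinearPMap.eq_of_le_of_isSelfAdjoint (hT : IsSelfAdjoint T) {S : H →ₗ.[ℂ] H}
    (hS : ∀ x y : S.domain, inner ℂ (S x) (y : H) = inner ℂ (x : H) (S y)) (h : T ≤ S) :
    T = S := by
  refine LinearPMap.eq_of_le_of_domain_eq h (le_antisymm h.1 fun x hx => ?_)
  refine (LinearPMap.exists_apply_eq_of_isSelfAdjoint hT (w := S ⟨x, hx⟩) fun y => ?_).1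
  have hy : T y = S ⟨y, h.1 y.2⟩ := h.2 rfl
  rw [hy]
  exact hS ⟨x, hx⟩ ⟨y, h.1 y.2⟩

/-- The resolvents `(T ± i)⁻¹` of a self-adjoint operator. -/
theorem LinearPMap.exists_resolvent (hT : IsSelfAdjoint T) {c : ℝ} (hc : c ^ 2 = 1) :
    ∃ R : H →L[ℂ] H, (∀ y, ∃ h : R y ∈ T.domain, T ⟨R y, h⟩ + (c * Complex.I) • R y = y) ∧
      ∀ x : T.domain, R (T x + (c * Complex.I) • (x : H)) = x := by
  have hsymm := LinearPMap.inner_apply_eq_of_isSelfAdjoint hT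
  have hc0 : c ≠ 0 := by
    rintro rfl
    norm_num at hc
  choose r hr using LinearPMap.exists_apply_add_smul_I_eq hT hc
  have hinj : ∀ x y : T.domain, T x + (c * Complex.I) • (x : H) = T y + (c * Complex.I) • (y : H) →
      (x : H) = y := by
    intro x y hxy
    have := LinearPMap.eq_zero_of_apply_add_smul_I_eq_zero hsymm hc0 (x := x - y) (by
      rw [LinearPMap.map_sub, Submodule.coe_sub, smul_sub, ← sub_eq_zero.2 hxy]
      abel)
    rwa [Submodule.coe_sub, sub_eq_zero] at this
  let R₀ : H →ₗ[ℂ] H :=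
    { toFun := fun y => r y
      map_add' := fun y z => hinj (r (y + z)) (r y + r z) (by
        rw [hr, LinearPMap.map_add, Submodule.coe_add, smul_add, add_add_add_comm, hr, hr])
      map_smul' := fun a y => hinj (r (a • y)) (a • r y) (by
        rw [hr, LinearPMap.map_smul, Submodule.coe_smul, smul_comm, ← smul_add, hr]) }
  refine ⟨R₀.mkContinuous 1 fun y => ?_, fun y => ⟨(r y).2, hr y⟩, fun x => hinj (r _) x (hr _)⟩
  rw [one_mul]
  refine abs_le_of_sq_le_sq' ?_ (norm_nonneg _) |>.2
  have h1 := LinearPMap.norm_add_smul_I_sq hsymm c (r y)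
  rw [hr, hc, one_mul] at h1
  change ‖(r y : H)‖ ^ 2 ≤ _
  nlinarith [sq_nonneg ‖T (r y)‖]

/-- The resolvent `R = (T + i)⁻¹` is normal, with `R* - R = 2i R* R`. -/
theorem LinearPMap.star_resolvent (hT : IsSelfAdjoint T) {R : H →L[ℂ] H}
    (h₁ : ∀ y, ∃ h : R y ∈ T.domain, T ⟨R y, h⟩ + Complex.I • R y = y)
    (h₂ : ∀ x : T.domain, R (T x + Complex.I • (x : H)) = x) :
    star R - R = (2 * Complex.I) • (star R * R) ∧ IsStarNormal R := by
  obtain ⟨Q, hQ₁, hQ₂⟩ := LinearPMap.exists_resolvent hT (c := -1) (by norm_num)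
  simp only [Complex.ofReal_neg, Complex.ofReal_one, neg_mul, one_mul] at hQ₁ hQ₂
  have hQ : star R = Q := by
    rw [ContinuousLinearMap.star_eq_adjoint, eq_comm, ContinuousLinearMap.eq_adjoint_iff]
    intro x y
    obtain ⟨hx, hx'⟩ := hQ₁ x
    obtain ⟨hy, hy'⟩ := h₁ y
    have hs := LinearPMap.inner_apply_eq_of_isSelfAdjoint hT ⟨Q x, hx⟩ ⟨R y, hy⟩
    conv_lhs => rw [← hy']
    conv_rhs => rw [← hx']
    rw [inner_add_left, inner_add_right, inner_smul_left, inner_smul_right, hs]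
    simp
  have hA : Q - R = (2 * Complex.I) • (Q * R) := by
    ext y
    obtain ⟨hy, hy'⟩ := h₁ y
    have h3 := hQ₂ ⟨R y, hy⟩
    have h4 : y = (T ⟨R y, hy⟩ + (-Complex.I) • R y) + (2 * Complex.I) • R y := by
      nth_rw 1 [← hy']
      module
    rw [_root_.sub_apply, _root_.smul_apply, mul_apply_eq_comp]
    nth_rw 1 [h4]
    rw [_root_.map_add, _root_.map_smul, h3]
    simp
  have hB : Q - R = (2 * Complex.I) • (R * Q) := by
    ext y
    obtain ⟨hy, hy'⟩ := hQ₁ y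
    have h3 := h₂ ⟨Q y, hy⟩
    have h4 : y = (T ⟨Q y, hy⟩ + Complex.I • Q y) + (-(2 * Complex.I)) • Q y := by
      nth_rw 1 [← hy']
      module
    rw [_root_.sub_apply, _root_.smul_apply, mul_apply_eq_comp]
    nth_rw 2 [h4]
    rw [_root_.map_add, _root_.map_smul, h3]
    simp
  refine ⟨by rw [hQ, hA], ⟨?_⟩⟩
  rw [hQ, commute_iff_eq]
  have h2I : (2 * Complex.I) ≠ 0 := by simp
  exact smul_right_injective _ h2I (hA.symm.trans hB)

end Resolvent

/-! ### Representations of `C_c(ℝ)` and projection-valued measures -/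

section Representation

open Filter Topology CompactlySupported

/-- Continuous functions `ℝ → ℂ` of compact support. -/
def IsCompactlySupported (f : ℝ → ℂ) : Prop := Continuous f ∧ HasCompactSupport f

theorem IsCompactlySupported.isBoundedBorel {f : ℝ → ℂ} (hf : IsCompactlySupported f) :
    IsBoundedBorel f :=
  IsBoundedBorel.of_hasCompactSupport hf.1 hf.2

theorem IsCompactlySupported.ofReal (f : C_c(ℝ, ℝ)) :
    IsCompactlySupported fun s => (f s : ℂ) :=
  ⟨Complex.continuous_ofReal.comp f.continuous,
    f.hasCompactSupport.comp_left (g := ((↑) : ℝ → ℂ)) Complex.ofReal_zero⟩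

/-- The cut-off functions which equal `1` on `[-n, n]` and vanish outside `[-(n+1), n+1]`. -/
noncomputable def cutoff (n : ℕ) : C_c(ℝ, ℝ) where
  toFun s := max 0 (min 1 (n + 1 - |s|))
  continuous_toFun := by fun_prop
  hasCompactSupport' := by
    refine HasCompactSupport.intro (isCompact_Icc (a := -(n + 1 : ℝ)) (b := n + 1)) fun s hs => ?_
    rw [Set.mem_Icc, ← abs_le, not_le] at hs
    exact max_eq_left ((min_le_right _ _).trans (by linarith))

theorem cutoff_apply (n : ℕ) (s : ℝ) : cutoff n s = max 0 (min 1 (n + 1 - |s|)) := rfl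

theorem cutoff_nonneg (n : ℕ) (s : ℝ) : 0 ≤ cutoff n s := le_max_left _ _

theorem cutoff_le_one (n : ℕ) (s : ℝ) : cutoff n s ≤ 1 := max_le zero_le_one (min_le_left _ _)

theorem cutoff_eq_one {n : ℕ} {s : ℝ} (h : |s| ≤ n) : cutoff n s = 1 := by
  rw [cutoff_apply, min_eq_left (by linarith), max_eq_right zero_le_one]

theorem monotone_cutoff (s : ℝ) : Monotone fun n => cutoff n s := by
  intro m n hmn
  have : (m : ℝ) ≤ n := by exact_mod_cast hmn
  exact max_le_max_left _ (min_le_min_left _ (by linarith))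

theorem tendsto_cutoff (s : ℝ) : Tendsto (fun n => cutoff n s) atTop (𝓝 1) := by
  refine tendsto_const_nhds.congr' ?_
  filter_upwards [(tendsto_natCast_atTop_atTop (R := ℝ)).eventually_ge_atTop |s|] with n hn
  exact (cutoff_eq_one hn).symm

variable {H : Type*} [NormedAddCommGroup H] [InnerProductSpace ℂ H] [CompleteSpace H]

/-- A nondegenerate `*`-representation `Φ` of `C_c(ℝ)`, given as a function on all of `ℝ → ℂ`
whose values elsewhere are irrelevant. -/
structure IsNondegenerateRepresentation (Φ : (ℝ → ℂ) → H →L[ℂ] H) : Prop where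
  map_add : ∀ f g, IsCompactlySupported f → IsCompactlySupported g → Φ (f + g) = Φ f + Φ g
  map_smul : ∀ (c : ℂ) f, IsCompactlySupported f → Φ (c • f) = c • Φ f
  map_mul : ∀ f g, IsCompactlySupported f → IsCompactlySupported g → Φ (f * g) = Φ f * Φ g
  map_star : ∀ f, IsCompactlySupported f → Φ (star f) = ContinuousLinearMap.adjoint (Φ f)
  tendsto_cutoff : ∀ ξ, Tendsto (fun n => Φ (fun s => (cutoff n s : ℂ)) ξ) atTop (𝓝 ξ)

namespace IsNondegenerateRepresentation

variable {Φ : (ℝ → ℂ) → H →L[ℂ] H}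

theorem inner_nonneg (h : IsNondegenerateRepresentation Φ) (ξ : H) (f : C_c(ℝ, ℝ))
    (hf : ∀ s, 0 ≤ f s) : 0 ≤ (inner ℂ ξ (Φ (fun s => (f s : ℂ)) ξ)).re := by
  let g : C_c(ℝ, ℝ) := f.compLeft ⟨fun x => √x, Real.continuous_sqrt⟩
  have hg : ∀ s, g s = √(f s) := fun s => by
    simp [g, CompactlySupportedContinuousMap.compLeft_apply]
  have hgc := IsCompactlySupported.ofReal g
  have h1 : (fun s => (f s : ℂ)) = star (fun s => (g s : ℂ)) * fun s => (g s : ℂ) := by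
    ext s
    simp only [Pi.mul_apply, Pi.star_apply, RCLike.star_def, Complex.conj_ofReal]
    rw [← Complex.ofReal_mul, hg, Real.mul_self_sqrt (hf s)]
  have hgs : IsCompactlySupported (star fun s => (g s : ℂ)) := by
    have : (star fun s => (g s : ℂ)) = fun s => (g s : ℂ) := by
      ext s
      simp
    rwa [this]
  rw [h1, h.map_mul _ _ hgs hgc, h.map_star _ hgc, mul_apply_eq_comp,
    ContinuousLinearMap.adjoint_inner_right]
  exact inner_self_nonneg (𝕜 := ℂ)

/-- The Riesz–Markov–Kakutani theorem provides the scalar spectral measures. -/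
theorem exists_measure (h : IsNondegenerateRepresentation Φ) (ξ : H) :
    ∃ μ : Measure ℝ, μ Set.univ = ENNReal.ofReal (‖ξ‖ ^ 2) ∧
      ∀ f, IsCompactlySupported f → inner ℂ ξ (Φ f ξ) = ∫ s, f s ∂μ := by
  have hc := fun f : C_c(ℝ, ℝ) => IsCompactlySupported.ofReal f
  let Λ₀ : C_c(ℝ, ℝ) →ₗ[ℝ] ℝ :=
    { toFun := fun f => (inner ℂ ξ (Φ (fun s => (f s : ℂ)) ξ)).re
      map_add' := fun f g => by
        have : (fun s => ((f + g) s : ℂ)) = (fun s => (f s : ℂ)) + fun s => (g s : ℂ) := by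
          ext s
          simp
        rw [this, h.map_add _ _ (hc f) (hc g), add_apply, inner_add_right, Complex.add_re]
      map_smul' := fun c f => by
        have : (fun s => ((c • f) s : ℂ)) = (c : ℂ) • fun s => (f s : ℂ) := by
          ext s
          simp
        rw [this, h.map_smul _ _ (hc f), smul_apply, inner_smul_right, Complex.re_ofReal_mul]
        rfl }
  let Λ : C_c(ℝ, ℝ) →ₚ[ℝ] ℝ := PositiveLinearMap.mk₀ Λ₀ fun f hf =>
    h.inner_nonneg ξ f fun s => hf s
  let μ := RealRMK.rieszMeasure Λ
  have hμ : ∀ f : C_c(ℝ, ℝ), inner ℂ ξ (Φ (fun s => (f s : ℂ)) ξ) = ∫ s, (f s : ℂ) ∂μ := by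
    intro f
    have h1 : ∫ s, f s ∂μ = (inner ℂ ξ (Φ (fun s => (f s : ℂ)) ξ)).re :=
      RealRMK.integral_rieszMeasure Λ f
    have h2 : ∫ s, (f s : ℂ) ∂μ = ((∫ s, f s ∂μ : ℝ) : ℂ) := integral_ofReal
    have hs : star (fun s => (f s : ℂ)) = fun s => (f s : ℂ) := by
      ext s
      simp
    rw [h2, h1, eq_comm, ← Complex.conj_eq_iff_re, inner_conj_symm,
      ← ContinuousLinearMap.adjoint_inner_right, ← h.map_star _ (hc f), hs]
  refine ⟨μ, ?_, fun f hf => ?_⟩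
  · have hint : ∀ f : C_c(ℝ, ℝ), Integrable f μ := fun f =>
      f.continuous.integrable_of_hasCompactSupport f.hasCompactSupport
    have h1 : Tendsto (fun n => ∫⁻ s, ENNReal.ofReal (cutoff n s) ∂μ) atTop
        (𝓝 (∫⁻ s, 1 ∂μ)) := by
      refine lintegral_tendsto_of_tendsto_of_monotone
        (fun n => (cutoff n).continuous.measurable.ennreal_ofReal.aemeasurable)
        (ae_of_all _ fun s m n hmn => ENNReal.ofReal_le_ofReal (monotone_cutoff s hmn))
        (ae_of_all _ fun s => ?_)
      have := ENNReal.tendsto_ofReal (_root_.tendsto_cutoff s)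
      rwa [ENNReal.ofReal_one] at this
    rw [lintegral_one] at h1
    refine tendsto_nhds_unique h1 ?_
    have h2 : Tendsto (fun n => (inner ℂ ξ (Φ (fun s => (cutoff n s : ℂ)) ξ)).re) atTop
        (𝓝 (‖ξ‖ ^ 2)) := by
      have h3 : Tendsto (fun n => inner ℂ ξ (Φ (fun s => (cutoff n s : ℂ)) ξ)) atTop
          (𝓝 (inner ℂ ξ ξ)) := tendsto_const_nhds.inner (h.tendsto_cutoff ξ)
      have h4 := (Complex.continuous_re.tendsto _).comp h3
      rwa [show (inner ℂ ξ ξ).re = ‖ξ‖ ^ 2 from inner_self_eq_norm_sq (𝕜 := ℂ) ξ] at h4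
    refine (ENNReal.tendsto_ofReal h2).congr fun n => ?_
    rw [← ofReal_integral_eq_lintegral_ofReal (hint _) (ae_of_all _ (cutoff_nonneg n))]
    congr 1
    exact (RealRMK.integral_rieszMeasure Λ (cutoff n)).symm
  · let u : C_c(ℝ, ℝ) := ⟨⟨fun s => (f s).re, Complex.continuous_re.comp hf.1⟩,
      hf.2.comp_left (g := Complex.re) Complex.zero_re⟩
    let v : C_c(ℝ, ℝ) := ⟨⟨fun s => (f s).im, Complex.continuous_im.comp hf.1⟩,
      hf.2.comp_left (g := Complex.im) Complex.zero_im⟩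
    have huv : f = (fun s => (u s : ℂ)) + Complex.I • fun s => (v s : ℂ) := by
      ext s
      rw [Pi.add_apply, Pi.smul_apply, smul_eq_mul, mul_comm]
      exact (Complex.re_add_im (f s)).symm
    have hv : IsCompactlySupported (Complex.I • fun s => (v s : ℂ)) :=
      ⟨(hc v).1.const_smul _, (hc v).2.smul_left⟩
    have hint : ∀ {g : ℝ → ℂ}, IsCompactlySupported g → Integrable g μ := fun hg =>
      hg.1.integrable_of_hasCompactSupport hg.2
    have h1 : ∫ s, f s ∂μ = ∫ s, (u s : ℂ) ∂μ + Complex.I * ∫ s, (v s : ℂ) ∂μ := by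
      refine (integral_congr_ae (ae_of_all _ fun s => congrFun huv s)).trans ?_
      refine (integral_add (hint (hc u)) (hint hv)).trans ?_
      exact congrArg _ (integral_const_mul _ _)
    rw [h1, ← hμ, ← hμ]
    nth_rw 1 [huv]
    rw [h.map_add _ _ (hc u) hv, h.map_smul _ _ (hc v), add_apply, smul_apply,
      inner_add_right, inner_smul_right]

/-- The representation extends to the bounded Borel functions, which are generated by `C_c(ℝ)` under
bounded pointwise limits, and the images of indicator functions give the projections. -/
theorem exists_projectionValuedMeasure (h : IsNondegenerateRepresentation Φ) :
    ∃ E : ProjectionValuedMeasure H, ∀ f, IsCompactlySupported f → E.bounded f = Φ f := by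
  choose μ mass hμ using h.exists_measure
  obtain ⟨Ψ, hΨ⟩ := exists_isBorelCalculus mass (G := {f | IsCompactlySupported f})
    (fun f hf => hf.isBoundedBorel)
    (fun P hP hG => hP.of_hasCompactSupport fun f hf hc => hG f ⟨hf, hc⟩) Φ
    (fun f hf ξ => hμ ξ f hf) (fun f hf g hg ξ => by
      rw [← hμ ξ (f * g) ⟨hf.1.mul hg.1, hf.2.mul_right⟩, h.map_mul f g hf hg,
        mul_apply_eq_comp])
  obtain ⟨E, hE⟩ := hΨ.exists_projectionValuedMeasure
  refine ⟨E, fun f hf => ContinuousLinearMap.ext_inner_self fun ξ => ?_⟩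
  rw [E.isBorelCalculus.inner_apply f hf.isBoundedBorel, hE, hμ ξ f hf]

end IsNondegenerateRepresentation

end Representation

/-! ### The spectral theorem for self-adjoint operators -/

section SpectralTheorem

open Filter Topology

variable {H : Type*} [NormedAddCommGroup H] [InnerProductSpace ℂ H] [CompleteSpace H]

/-- The function `z ↦ f(Re(1/z))`, extended by `0` at `z = 0`. On the spectrum of `(T + i)⁻¹` the
variable is `z = 1/(s + i)` with `s` real, and `f` is recovered as a function of `s`. -/
noncomputable def resolventPullback (f : ℝ → ℂ) (z : ℂ) : ℂ := if z = 0 then 0 else f z⁻¹.re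

/-- The points `1/(s + i)` with `s` real, together with `0`. -/
def resolventCircle : Set ℂ := {z | star z - z = 2 * Complex.I * (star z * z)}

theorem inv_im_of_mem_resolventCircle {z : ℂ} (hz : z ∈ resolventCircle) (h0 : z ≠ 0) :
    z⁻¹.im = 1 := by
  have h1 := congrArg Complex.im (show star z - z = 2 * Complex.I * (star z * z) from hz)
  rw [RCLike.star_def, mul_comm ((starRingEnd ℂ) z) z, Complex.mul_conj] at h1
  simp only [Complex.sub_im, Complex.conj_im, Complex.mul_im, Complex.mul_re, Complex.I_re,
    Complex.I_im, Complex.ofReal_re, Complex.ofReal_im, Complex.re_ofNat, Complex.im_ofNat] at h1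
  have h2 : Complex.normSq z ≠ 0 := by simpa using h0
  rw [Complex.inv_im, div_eq_one_iff_eq h2]
  linarith

theorem inv_eq_of_mem_resolventCircle {z : ℂ} (hz : z ∈ resolventCircle) (h0 : z ≠ 0) :
    z⁻¹ = z⁻¹.re + Complex.I := by
  apply Complex.ext <;> simp [-Complex.inv_re, -Complex.inv_im, inv_im_of_mem_resolventCircle hz h0]

/-- Near `z = 0` on the circle `|Re (1/z)|` is large, so compactly supported `f` vanish there. -/
theorem continuousOn_resolventPullback {f : ℝ → ℂ} (hf : IsCompactlySupported f) :
    ContinuousOn (resolventPullback f) resolventCircle := by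
  intro z hz
  by_cases h0 : z = 0
  · subst h0
    obtain ⟨M, hM0, hM⟩ := hf.2.isCompact.isBounded.subset_ball_lt 0 0
    have hev : ∀ᶠ w in 𝓝[resolventCircle] (0 : ℂ), resolventPullback f w = 0 := by
      have hball : ∀ᶠ w in 𝓝[resolventCircle] (0 : ℂ), ‖w‖ < (M + 1)⁻¹ := by
        refine nhdsWithin_le_nhds ?_
        have := Metric.ball_mem_nhds (0 : ℂ) (inv_pos.2 (by linarith : 0 < M + 1))
        filter_upwards [this] with w hw
        simpa using hw
      filter_upwards [hball, self_mem_nhdsWithin] with w hw hwc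
      by_cases hw0 : w = 0
      · simp [resolventPullback, hw0]
      · rw [resolventPullback, if_neg hw0]
        by_contra hne
        have h1 := hM (subset_tsupport f hne)
        rw [mem_ball_zero_iff, Real.norm_eq_abs] at h1
        have h2 : M + 1 < ‖w⁻¹‖ := by
          rw [norm_inv]
          exact (lt_inv_comm₀ (by linarith) (norm_pos_iff.2 hw0)).2 hw
        have h3 := Complex.norm_le_abs_re_add_abs_im w⁻¹
        rw [inv_im_of_mem_resolventCircle hwc hw0, abs_one] at h3
        linarith
    refine ContinuousWithinAt.congr_of_eventuallyEq (f := fun _ => (0 : ℂ))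
      continuousWithinAt_const hev ?_
    simp [resolventPullback]
  · have h1 : ContinuousAt (fun w : ℂ => f w⁻¹.re) z :=
      ContinuousAt.comp (f := fun w : ℂ => w⁻¹.re) hf.1.continuousAt
        (Complex.continuous_re.continuousAt.comp (continuousAt_inv₀ h0))
    refine (h1.congr ?_).continuousWithinAt
    filter_upwards [isOpen_ne.mem_nhds h0] with w hw
    simp only [resolventPullback, if_neg (show w ≠ 0 from hw)]

theorem resolventPullback_cutoff_sub_one_mul_le (n : ℕ) {z : ℂ} (hz : z ∈ resolventCircle) :
    ‖resolventPullback (fun s => (cutoff n s : ℂ)) z * z - z‖ ≤ 1 / (n + 1 : ℝ) * 2 := by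
  by_cases h0 : z = 0
  · subst h0
    simp only [mul_zero, sub_zero, norm_zero]
    positivity
  · rw [resolventPullback, if_neg h0]
    by_cases hn : |z⁻¹.re| ≤ n
    · rw [cutoff_eq_one hn]
      simp only [Complex.ofReal_one, one_mul, sub_self, norm_zero]
      positivity
    · push Not at hn
      have h1 : ((cutoff n z⁻¹.re : ℝ) : ℂ) * z - z = ((cutoff n z⁻¹.re - 1 : ℝ) : ℂ) * z := by
        push_cast
        ring
      have h2 : ‖((cutoff n z⁻¹.re - 1 : ℝ) : ℂ)‖ ≤ 1 := by
        rw [Complex.norm_real, Real.norm_eq_abs, abs_le]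
        constructor <;> linarith [cutoff_nonneg n z⁻¹.re, cutoff_le_one n z⁻¹.re]
      have h3 : ‖z‖ ≤ 1 / (n + 1 : ℝ) * 2 := by
        have h4 : (n + 1 : ℝ) / 2 ≤ ‖z⁻¹‖ := by
          have h5 := Complex.abs_re_le_norm z⁻¹
          have h6 := Complex.abs_im_le_norm z⁻¹
          rw [inv_im_of_mem_resolventCircle hz h0, abs_one] at h6
          linarith
        rw [norm_inv] at h4
        have h5 := inv_anti₀ (by positivity) h4
        rw [inv_inv, inv_div] at h5
        exact h5.trans_eq (by ring)
      rw [h1, norm_mul]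
      exact (mul_le_of_le_one_left (norm_nonneg _) h2).trans h3

variable {R : H →L[ℂ] H}

theorem spectrum_subset_resolventCircle (hR : IsStarNormal R)
    (h : star R - R = (2 * Complex.I) • (star R * R)) : spectrum ℂ R ⊆ resolventCircle := by
  have h1 : cfc (fun z : ℂ => star z - z) R =
      cfc (fun z : ℂ => (2 * Complex.I) * (star z * z)) R := by
    rw [cfc_sub (fun z : ℂ => star z) (fun z => z) R, cfc_const_mul _ _ R,
      cfc_mul (fun z : ℂ => star z) (fun z => z) R, cfc_star (fun z : ℂ => z) R, cfc_id' ℂ R, h]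
  exact (cfc_eq_cfc_iff_eqOn hR).1 h1

/-- The continuous functional calculus of a resolvent restricts to a representation of `C_c(ℝ)`; it
is nondegenerate because `z = 0` is the only point missed, and `R` has dense range. -/
theorem isNondegenerateRepresentation_cfc (hR : IsStarNormal R)
    (h : star R - R = (2 * Complex.I) • (star R * R)) (hd : DenseRange R) :
    IsNondegenerateRepresentation fun f => cfc (resolventPullback f) R := by
  have hsp := spectrum_subset_resolventCircle hR h
  have hc := fun {f : ℝ → ℂ} (hf : IsCompactlySupported f) =>
    (continuousOn_resolventPullback hf).mono hsp
  have hχ := fun n => IsCompactlySupported.ofReal (cutoff n)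
  refine ⟨fun f g hf hg => ?_, fun c f hf => ?_, fun f g hf hg => ?_, fun f hf => ?_, fun ξ => ?_⟩
  · rw [← cfc_add R _ _ (hc hf) (hc hg)]
    congr 1
    ext z
    by_cases h0 : z = 0 <;> simp [resolventPullback, h0]
  · rw [← cfc_const_mul c _ R (hc hf)]
    congr 1
    ext z
    by_cases h0 : z = 0 <;> simp [resolventPullback, h0]
  · rw [← cfc_mul _ _ R (hc hf) (hc hg)]
    congr 1
    ext z
    by_cases h0 : z = 0 <;> simp [resolventPullback, h0]
  · rw [← ContinuousLinearMap.star_eq_adjoint, ← cfc_star]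
    congr 1
    ext z
    by_cases h0 : z = 0 <;> simp [resolventPullback, h0]
  · -- convergence on the dense range of `R`, and a uniform bound
    have hnorm : ∀ n η, ‖cfc (resolventPullback fun s => (cutoff n s : ℂ)) R η‖ ≤ ‖η‖ := by
      intro n η
      refine (ContinuousLinearMap.le_of_opNorm_le _ (c := 1) ?_ η).trans_eq (one_mul _)
      refine norm_cfc_le zero_le_one fun z hz => ?_
      by_cases h0 : z = 0
      · simp [resolventPullback, h0]
      · rw [resolventPullback, if_neg h0, Complex.norm_real,
          Real.norm_of_nonneg (cutoff_nonneg _ _)]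
        exact cutoff_le_one _ _
    have hR' : ∀ n, ‖cfc (resolventPullback fun s => (cutoff n s : ℂ)) R * R - R‖ ≤
        1 / (n + 1 : ℝ) * 2 := by
      intro n
      have : cfc (resolventPullback fun s => (cutoff n s : ℂ)) R * R - R =
          cfc (fun z => resolventPullback (fun s => (cutoff n s : ℂ)) z * z - z) R := by
        rw [cfc_sub _ (fun z => z) R
            (by exact (hc (hχ n)).mul continuousOn_id),
          cfc_mul _ (fun z => z) R (hc (hχ n)), cfc_id' ℂ R]
      rw [this]
      exact norm_cfc_le (by positivity) fun z hz =>
        resolventPullback_cutoff_sub_one_mul_le n (hsp hz)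
    have hlim : Tendsto (fun n : ℕ => 1 / (n + 1 : ℝ) * 2) atTop (𝓝 0) := by
      simpa using (tendsto_one_div_add_atTop_nhds_zero_nat (𝕜 := ℝ)).mul_const 2
    rw [Metric.tendsto_atTop]
    intro ε hε
    obtain ⟨η, hη⟩ := Metric.denseRange_iff.1 hd ξ (ε / 3) (by positivity)
    have h1 : Tendsto (fun n : ℕ => 1 / (n + 1 : ℝ) * 2 * ‖η‖) atTop (𝓝 0) := by
      simpa using hlim.mul_const ‖η‖
    obtain ⟨N, hN⟩ := eventually_atTop.1 (h1.eventually_lt_const (by positivity : 0 < ε / 3))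
    refine ⟨N, fun n hn => ?_⟩
    set A := cfc (resolventPullback fun s => (cutoff n s : ℂ)) R
    have e1 : A ξ - ξ = A (ξ - R η) + (A * R - R) η + (R η - ξ) := by
      rw [map_sub, sub_apply, mul_apply_eq_comp]
      abel
    rw [dist_eq_norm] at hη ⊢
    have e2 := hnorm n (ξ - R η)
    have e3 := ((A * R - R).le_of_opNorm_le (hR' n) η).trans_lt (hN n hn)
    have e4 : ‖R η - ξ‖ < ε / 3 := by rwa [norm_sub_rev]
    rw [e1]
    refine (norm_add_le _ _).trans_lt ?_
    have := norm_add_le (A (ξ - R η)) ((A * R - R) η)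
    linarith

theorem isBoundedBorel_inv_add_I : IsBoundedBorel fun s : ℝ => ((s : ℂ) + Complex.I)⁻¹ := by
  refine ⟨by fun_prop, 1, fun s => ?_⟩
  rw [norm_inv]
  refine inv_le_one_of_one_le₀ ?_
  have := Complex.abs_im_le_norm ((s : ℂ) + Complex.I)
  simpa using this

theorem add_I_ne_zero (s : ℝ) : (s : ℂ) + Complex.I ≠ 0 := fun h => by
  have := congrArg Complex.im h
  simp at this

/-- If `R` is the resolvent `(T + i)⁻¹`, then `R = ∫ (s + i)⁻¹ dE(s)` for the projection-valued
measure `E` of the representation `f ↦ f(Re R⁻¹)` of `C_c(ℝ)`. -/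
theorem exists_projectionValuedMeasure_of_resolvent (hR : IsStarNormal R)
    (h : star R - R = (2 * Complex.I) • (star R * R)) (hd : DenseRange R) :
    ∃ E : ProjectionValuedMeasure H, E.bounded (fun s => ((s : ℂ) + Complex.I)⁻¹) = R := by
  have hrep := isNondegenerateRepresentation_cfc hR h hd
  obtain ⟨E, hE⟩ := hrep.exists_projectionValuedMeasure
  have hsp := spectrum_subset_resolventCircle hR h
  refine ⟨E, ?_⟩
  ext ξ
  have hχ := fun n => IsCompactlySupported.ofReal (cutoff n)
  have hr : Continuous fun s : ℝ => ((s : ℂ) + Complex.I)⁻¹ :=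
    Continuous.inv₀ (by fun_prop) add_I_ne_zero
  let F : ℕ → ℝ → ℂ := fun n => (fun s : ℝ => (cutoff n s : ℂ)) * fun s : ℝ =>
    ((s : ℂ) + Complex.I)⁻¹
  have hF : ∀ n, IsCompactlySupported (F n) := fun n =>
    ⟨(hχ n).1.mul hr, (hχ n).2.mul_right⟩
  have h1 : Tendsto (fun n => E.bounded (F n) ξ) atTop
      (𝓝 (E.bounded (fun s => ((s : ℂ) + Complex.I)⁻¹) ξ)) := by
    obtain ⟨C, hC⟩ := isBoundedBorel_inv_add_I.2
    refine E.isBorelCalculus.tendsto_apply (C := C) (fun n => (hF n).1.measurable)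
      isBoundedBorel_inv_add_I (fun n s => ?_) (fun s => ?_) ξ
    · simp only [F, Pi.mul_apply]
      rw [norm_mul, Complex.norm_real, Real.norm_of_nonneg (cutoff_nonneg n s)]
      exact (mul_le_of_le_one_left (norm_nonneg _) (cutoff_le_one n s)).trans (hC s)
    · have := ((Complex.continuous_ofReal.tendsto _).comp (tendsto_cutoff s)).mul_const
        ((s : ℂ) + Complex.I)⁻¹
      rw [Complex.ofReal_one, one_mul] at this
      exact this
  refine tendsto_nhds_unique h1 ((hrep.tendsto_cutoff (R ξ)).congr fun n => ?_)
  rw [hE _ (hF n), ← mul_apply_eq_comp]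
  congr 1
  nth_rw 2 [← cfc_id' ℂ R]
  rw [← cfc_mul _ (fun z => z) R ((continuousOn_resolventPullback (hχ n)).mono hsp)]
  refine cfc_congr fun z hz => ?_
  by_cases h0 : z = 0
  · simp [resolventPullback, h0]
  · simp only [resolventPullback, if_neg h0, F, Pi.mul_apply]
    rw [← inv_eq_of_mem_resolventCircle (hsp hz) h0, inv_inv]

/-- The spectral theorem: existence of the spectral measure. -/
theorem exists_isIntegral_id {T : H →ₗ.[ℂ] H} (hT : IsSelfAdjoint T) :
    ∃ E : ProjectionValuedMeasure H, E.IsIntegral (fun s : ℝ => (s : ℂ)) T := by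
  obtain ⟨R, h₁, h₂⟩ := LinearPMap.exists_resolvent hT (c := 1) (by norm_num)
  simp only [Complex.ofReal_one, one_mul] at h₁ h₂
  obtain ⟨hR, hn⟩ := LinearPMap.star_resolvent hT h₁ h₂
  have hd : DenseRange R := hT.dense_domain.mono fun x hx => ⟨_, h₂ ⟨x, hx⟩⟩
  obtain ⟨E, hE⟩ := exists_projectionValuedMeasure_of_resolvent hn hR hd
  have hm : Measurable fun s : ℝ => (s : ℂ) := Complex.measurable_ofReal
  have hA := E.isIntegral_integral hm
  have hfg : (fun s : ℝ => (s : ℂ)) * (fun s : ℝ => ((s : ℂ) + Complex.I)⁻¹) =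
      1 - Complex.I • fun s : ℝ => ((s : ℂ) + Complex.I)⁻¹ := by
    ext s
    simp only [Pi.mul_apply, Pi.sub_apply, Pi.one_apply, Pi.smul_apply, smul_eq_mul]
    have := add_I_ne_zero s
    field_simp
    ring
  have hr := isBoundedBorel_inv_add_I
  have hone : IsBoundedBorel 1 := IsBoundedBorel.const 1
  -- `∫ s dE(s)` is a symmetric extension of `T`, hence equal to it
  have hle : T ≤ E.integral fun s : ℝ => (s : ℂ) := by
    have key : ∀ x : T.domain, ∃ hx : (x : H) ∈ (E.integral fun s : ℝ => (s : ℂ)).domain,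
        (E.integral fun s : ℝ => (s : ℂ)) ⟨x, hx⟩ = T x := by
      intro x
      obtain ⟨hx, hx'⟩ := hA.exists_apply_bounded hm hr
        (by rw [hfg]; exact hone.sub (hr.smul _)) (T x + Complex.I • (x : H))
      rw [hfg, E.isBorelCalculus.map_sub hone (hr.smul _), E.isBorelCalculus.map_one,
        E.isBorelCalculus.map_smul _ hr] at hx'
      have hEx : E.bounded (fun s => ((s : ℂ) + Complex.I)⁻¹) (T x + Complex.I • (x : H)) = x := by
        rw [hE, h₂]
      simp only [sub_apply, smul_apply, one_apply_eq_self, hEx, add_sub_cancel_right] at hx' hx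
      exact ⟨hx, hx'⟩
    refine ⟨fun x hx => (key ⟨x, hx⟩).1, fun x y hxy => ?_⟩
    obtain ⟨hx, hx'⟩ := key x
    rw [← hx']
    congr 1
    exact Subtype.ext hxy
  have hsymm : ∀ x y : (E.integral fun s : ℝ => (s : ℂ)).domain,
      inner ℂ (E.integral (fun s : ℝ => (s : ℂ)) x) (y : H) =
        inner ℂ (x : H) (E.integral (fun s : ℝ => (s : ℂ)) y) := by
    intro x y
    have e1 : Tendsto
        (fun n => inner ℂ (E.bounded (truncate (fun s : ℝ => (s : ℂ)) n) (x : H)) (y : H))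
        atTop (𝓝 (inner ℂ (E.integral (fun s : ℝ => (s : ℂ)) x) (y : H))) :=
      (hA.tendsto_truncate hm x).inner tendsto_const_nhds
    have e2 : Tendsto
        (fun n => inner ℂ (x : H) (E.bounded (truncate (fun s : ℝ => (s : ℂ)) n) (y : H)))
        atTop (𝓝 (inner ℂ (x : H) (E.integral (fun s : ℝ => (s : ℂ)) y))) :=
      tendsto_const_nhds.inner (hA.tendsto_truncate hm y)
    refine tendsto_nhds_unique e1 (e2.congr fun n => ?_)
    have hstar : star (truncate (fun s : ℝ => (s : ℂ)) n) = truncate (fun s : ℝ => (s : ℂ)) n := by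
      ext s
      by_cases hs : |s| ≤ n <;> simp [truncate, Set.indicator, hs]
    nth_rw 1 [← hstar]
    rw [E.isBorelCalculus.map_star (IsBoundedBorel.truncate hm n),
      ContinuousLinearMap.adjoint_inner_right]
  exact ⟨E, (LinearPMap.eq_of_le_of_isSelfAdjoint hT hsymm hle) ▸ hA⟩

theorem isIntegral_spectralMeasure {T : H →ₗ.[ℂ] H} (hT : IsSelfAdjoint T) :
    (spectralMeasure T).IsIntegral (fun s : ℝ => (s : ℂ)) T :=
  Classical.epsilon_spec (exists_isIntegral_id hT)

theorem borelCalculus_ofReal {T : H →ₗ.[ℂ] H} (hT : IsSelfAdjoint T) :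
    borelCalculus T (fun s : ℝ => (s : ℂ)) = T :=
  ((isIntegral_spectralMeasure hT).eq_integral Complex.measurable_ofReal).symm

theorem expI_eq (T : H →ₗ.[ℂ] H) (t : ℝ) : expI T t =
    ((spectralMeasure T).bounded (fun s => Complex.exp (Complex.I * t * s)) :
      H →ₗ[ℂ] H).toPMap ⊤ :=
  (spectralMeasure T).integral_eq_bounded (IsBoundedBorel.cexp t)

end SpectralTheorem

/-! ### One-parameter unitary groups and Stone's theorem -/

section Stone

open Filter Topology Set

variable {H : Type*} [NormedAddCommGroup H] [InnerProductSpace ℂ H] [CompleteSpace H]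

/-- A symmetric operator `T` with `T ± i` onto is densely defined and self-adjoint. -/
theorem LinearPMap.isSelfAdjoint_of_surjective {T : H →ₗ.[ℂ] H}
    (hT : ∀ x y : T.domain, inner ℂ (T x) (y : H) = inner ℂ (x : H) (T y))
    (h₁ : ∀ w : H, ∃ x : T.domain, T x + Complex.I • (x : H) = w)
    (h₂ : ∀ w : H, ∃ x : T.domain, T x - Complex.I • (x : H) = w) : IsSelfAdjoint T := by
  have hd : Dense (T.domain : Set H) := by
    rw [Submodule.dense_iff_topologicalClosure_eq_top,
      Submodule.topologicalClosure_eq_top_iff, Submodule.eq_bot_iff]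
    intro w hw
    obtain ⟨x, rfl⟩ := h₁ w
    have h3 := (Submodule.mem_orthogonal' _ _).1 hw x x.2
    rw [inner_add_left, inner_smul_left, inner_self_eq_norm_sq_to_K] at h3
    have him : (inner ℂ (T x) (x : H)).im = 0 := by
      rw [← Complex.conj_eq_iff_im, inner_conj_symm, hT x x]
    have h4 := congrArg Complex.im h3
    have h5 : ((‖(x : H)‖ : ℂ) ^ 2) = ((‖(x : H)‖ ^ 2 : ℝ) : ℂ) := by push_cast; rfl
    erw [h5] at h4
    rw [Complex.add_im, him, Complex.im_mul_ofReal] at h4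
    have h6 : (x : H) = 0 := by
      simpa using h4
    have h7 : x = 0 := Subtype.ext h6
    rw [h6, h7, LinearPMap.map_zero, smul_zero, add_zero]
  have hle : T ≤ LinearPMap.adjoint T := LinearPMap.IsFormalAdjoint.le_adjoint hd hT
  refine LinearPMap.isSelfAdjoint_def.2 (LinearPMap.eq_of_le_of_domain_eq hle
    (le_antisymm hle.1 fun y hy => ?_)).symm
  obtain ⟨x, hx⟩ := h₁ (LinearPMap.adjoint T ⟨y, hy⟩ + Complex.I • y)
  have h3 : y - x = 0 := by
    obtain ⟨z, hz⟩ := h₂ (y - x)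
    have h4 : inner ℂ (LinearPMap.adjoint T ⟨y, hy⟩) (z : H) = inner ℂ y (T z) :=
      LinearPMap.adjoint_isFormalAdjoint hd ⟨y, hy⟩ z
    have h5 : inner ℂ (y - (x : H)) (T z - Complex.I • (z : H)) = 0 := by
      have h6 : LinearPMap.adjoint T ⟨y, hy⟩ = T x + Complex.I • (x : H) - Complex.I • y :=
        eq_sub_of_add_eq hx.symm
      rw [h6] at h4
      simp only [inner_sub_left, inner_add_left, inner_sub_right, inner_smul_left,
        inner_smul_right, hT x z, Complex.conj_I] at h4 ⊢
      linear_combination -h4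
    rw [hz] at h5
    exact inner_self_eq_zero.1 h5
  rw [sub_eq_zero.1 h3]
  exact x.2

namespace IsOneParameterUnitaryGroup

variable {U : ℝ → H →L[ℂ] H}

theorem norm_apply (hU : IsOneParameterUnitaryGroup U) (t : ℝ) (ξ : H) : ‖U t ξ‖ = ‖ξ‖ :=
  (U t).norm_map_of_mem_unitary (hU.mem_unitary t) ξ

theorem inner_apply_apply (hU : IsOneParameterUnitaryGroup U) (t : ℝ) (ξ η : H) :
    inner ℂ (U t ξ) (U t η) = inner ℂ ξ η :=
  (U t).inner_map_map_of_mem_unitary (hU.mem_unitary t) ξ η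

theorem apply_add (hU : IsOneParameterUnitaryGroup U) (s t : ℝ) (ξ : H) :
    U (s + t) ξ = U s (U t ξ) := by
  rw [hU.map_add, mul_apply_eq_comp]

theorem comp_neg (hU : IsOneParameterUnitaryGroup U) :
    IsOneParameterUnitaryGroup fun t => U (-t) where
  mem_unitary t := hU.mem_unitary _
  map_zero := by rw [neg_zero, hU.map_zero]
  map_add s t := by rw [neg_add, hU.map_add]
  continuous ξ := (hU.continuous ξ).comp continuous_neg

theorem hasDerivAt (hU : IsOneParameterUnitaryGroup U) {ξ η : H}
    (h : HasDerivAt (fun t => U t ξ) η 0) (t : ℝ) : HasDerivAt (fun t => U t ξ) (U t η) t := by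
  have h1 : HasDerivAt (fun s => U (s - t) ξ) η t :=
    HasDerivAt.comp_sub_const t t (by rwa [sub_self])
  have h2 := ((U t).restrictScalars ℝ).hasFDerivAt.comp_hasDerivAt t h1
  refine h2.congr_of_eventuallyEq (Eventually.of_forall fun s => ?_)
  simp only [Function.comp_apply, ContinuousLinearMap.coe_restrictScalars']
  rw [← hU.apply_add, add_sub_cancel]

/-- The Laplace transform `ξ = ∫₀^∞ e⁻ᵗ U(t) η dt` solves `ξ - U'(0) ξ = η`. -/
theorem exists_hasDerivAt (hU : IsOneParameterUnitaryGroup U) (η : H) :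
    ∃ ξ, HasDerivAt (fun t => U t ξ) (ξ - η) 0 := by
  let g : ℝ → H := fun t => Real.exp (-t) • U t η
  have hg : Continuous g := by
    have := hU.continuous η
    fun_prop
  have hgi : ∀ a, IntegrableOn g (Ioi a) := by
    intro a
    refine ((integrableOn_exp_neg_Ioi a).mul_const ‖η‖).mono' hg.aestronglyMeasurable
      (ae_of_all _ fun t => ?_)
    rw [norm_smul, hU.norm_apply, Real.norm_of_nonneg (Real.exp_pos _).le]
  have hsplit : ∀ h, ∫ t in Ioi h, g t = (∫ t in Ioi 0, g t) - ∫ t in (0 : ℝ)..h, g t := by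
    intro h
    rcases le_total 0 h with h0 | h0
    · rw [← intervalIntegral.integral_Ioi_sub_Ioi (hgi 0) h0]
      abel
    · rw [intervalIntegral.integral_symm, ← intervalIntegral.integral_Ioi_sub_Ioi (hgi h) h0]
      abel
  have hUξ : ∀ h, U h (∫ t in Ioi 0, g t) =
      Real.exp h • ((∫ t in Ioi 0, g t) - ∫ t in (0 : ℝ)..h, g t) := by
    intro h
    rw [← hsplit, ← ContinuousLinearMap.integral_comp_comm (U h) (hgi 0), ← integral_smul]
    have hpre : (fun t => t + h) ⁻¹' Ioi h = Ioi 0 := by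
      ext t
      simp
    have hshift := (measurePreserving_add_right volume h).setIntegral_preimage_emb
      (measurableEmbedding_addRight h) (fun t => Real.exp h • g t) (Ioi h)
    rw [hpre] at hshift
    rw [← hshift]
    refine setIntegral_congr_fun measurableSet_Ioi fun t _ => ?_
    simp only [g]
    rw [smul_smul, ← Real.exp_add, add_comm t h, hU.apply_add,
      ContinuousLinearMap.map_smul_of_tower]
    congr 2
    ring
  refine ⟨∫ t in Ioi 0, g t, ?_⟩
  simp only [hUξ]
  have h1 := (hg.integral_hasStrictDerivAt 0 0).hasDerivAt
  have h2 := (Real.hasDerivAt_exp 0).smul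
    ((hasDerivAt_const (0 : ℝ) (∫ t in Ioi 0, g t)).sub h1)
  refine h2.congr_deriv ?_
  have h0 : g 0 = η := by simp [g, hU.map_zero]
  rw [h0, Real.exp_zero, one_smul, one_smul, Pi.sub_apply, intervalIntegral.integral_same]
  abel

/-- The infinitesimal generator `T = -i U'(0)`. -/
theorem exists_generator (hU : IsOneParameterUnitaryGroup U) :
    ∃ T : H →ₗ.[ℂ] H, IsSelfAdjoint T ∧ ∀ ξ η : H,
      (∃ h : ξ ∈ T.domain, T ⟨ξ, h⟩ = η) ↔ HasDerivAt (fun t => U t ξ) (Complex.I • η) 0 := by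
  have hadd : ∀ {ξ ξ' η η' : H}, HasDerivAt (fun t => U t ξ) (Complex.I • η) 0 →
      HasDerivAt (fun t => U t ξ') (Complex.I • η') 0 →
      HasDerivAt (fun t => U t (ξ + ξ')) (Complex.I • (η + η')) 0 := by
    intro ξ ξ' η η' h h'
    rw [smul_add]
    exact (h.add h').congr_of_eventuallyEq (Eventually.of_forall fun t => _root_.map_add _ _ _)
  have hsmul : ∀ (c : ℂ) {ξ η : H}, HasDerivAt (fun t => U t ξ) (Complex.I • η) 0 →
      HasDerivAt (fun t => U t (c • ξ)) (Complex.I • c • η) 0 := by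
    intro c ξ η h
    rw [smul_comm]
    exact (h.const_smul c).congr_of_eventuallyEq
      (Eventually.of_forall fun t => _root_.map_smul _ _ _)
  let D : Submodule ℂ H :=
    { carrier := {ξ | ∃ η, HasDerivAt (fun t => U t ξ) (Complex.I • η) 0}
      add_mem' := by
        rintro ξ ξ' ⟨η, h⟩ ⟨η', h'⟩
        exact ⟨η + η', hadd h h'⟩
      zero_mem' := ⟨0, by simpa only [_root_.map_zero, smul_zero] using hasDerivAt_const _ _⟩
      smul_mem' := by
        rintro c ξ ⟨η, h⟩
        exact ⟨c • η, hsmul c h⟩ }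
  have huniq : ∀ {ξ η η' : H}, HasDerivAt (fun t => U t ξ) (Complex.I • η) 0 →
      HasDerivAt (fun t => U t ξ) (Complex.I • η') 0 → η = η' := fun h h' =>
    smul_right_injective H Complex.I_ne_zero (h.unique h')
  choose a ha using fun ξ : D => ξ.2
  let T : H →ₗ.[ℂ] H :=
    { domain := D
      toFun :=
        { toFun := a
          map_add' := fun ξ η => huniq (ha (ξ + η)) (hadd (ha ξ) (ha η))
          map_smul' := fun c ξ => huniq (ha (c • ξ)) (hsmul c (ha ξ)) } }
  have hT : ∀ ξ η : H, (∃ h : ξ ∈ T.domain, T ⟨ξ, h⟩ = η) ↔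
      HasDerivAt (fun t => U t ξ) (Complex.I • η) 0 := by
    intro ξ η
    constructor
    · rintro ⟨h, rfl⟩
      exact ha ⟨ξ, h⟩
    · exact fun h => ⟨⟨η, h⟩, huniq (ha ⟨ξ, ⟨η, h⟩⟩) h⟩
  refine ⟨T, ?_, hT⟩
  have hder : ∀ x : T.domain, HasDerivAt (fun t => U t (x : H)) (Complex.I • T x) 0 := ha
  refine LinearPMap.isSelfAdjoint_of_surjective (fun x y => ?_) (fun w => ?_) (fun w => ?_)
  · have h1 := (hder x).inner ℂ (hder y)
    simp only [hU.inner_apply_apply, hU.map_zero, one_apply_eq_self] at h1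
    have h2 := (hasDerivAt_const (0 : ℝ) (inner ℂ (x : H) (y : H))).unique h1
    rw [inner_smul_left, inner_smul_right, Complex.conj_I] at h2
    have h3 : Complex.I * (inner ℂ (x : H) (T y) - inner ℂ (T x) (y : H)) = 0 := by
      linear_combination -h2
    exact (sub_eq_zero.1 ((mul_eq_zero.1 h3).resolve_left Complex.I_ne_zero)).symm
  · obtain ⟨ξ, hξ⟩ := hU.exists_hasDerivAt (-Complex.I • w)
    obtain ⟨h, hη⟩ := (hT ξ (w - Complex.I • ξ)).2 (by
      convert hξ using 1
      rw [smul_sub, smul_smul, Complex.I_mul_I]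
      module)
    exact ⟨⟨ξ, h⟩, by rw [hη]; exact sub_add_cancel _ _⟩
  · obtain ⟨ξ, hξ⟩ := hU.comp_neg.exists_hasDerivAt (Complex.I • w)
    obtain ⟨h, hη⟩ := (hT ξ (w + Complex.I • ξ)).2 (by
      have h1 : HasDerivAt (fun t => U (-t) ξ) (ξ - Complex.I • w) (-0 : ℝ) := by rwa [neg_zero]
      have h2 := h1.scomp (0 : ℝ) (hasDerivAt_neg (0 : ℝ))
      convert h2 using 1
      · ext t
        simp
      · rw [smul_add, smul_smul, Complex.I_mul_I]
        module)
    exact ⟨⟨ξ, h⟩, by rw [hη]; exact add_sub_cancel_right _ _⟩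

end IsOneParameterUnitaryGroup

theorem ProjectionValuedMeasure.isOneParameterUnitaryGroup (E : ProjectionValuedMeasure H) :
    IsOneParameterUnitaryGroup fun t : ℝ =>
      E.bounded fun s => Complex.exp (Complex.I * t * s) := by
  have hc := E.isBorelCalculus
  have hadd : ∀ s t : ℝ, E.bounded (fun x => Complex.exp (Complex.I * ((s + t : ℝ) : ℂ) * x)) =
      E.bounded (fun x => Complex.exp (Complex.I * s * x)) *
        E.bounded (fun x => Complex.exp (Complex.I * t * x)) := by
    intro s t
    rw [← hc.map_mul _ _ (IsBoundedBorel.cexp s) (IsBoundedBorel.cexp t)]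
    congr 1
    ext x
    rw [Pi.mul_apply, ← Complex.exp_add]
    congr 1
    push_cast
    ring
  have hzero : E.bounded (fun x => Complex.exp (Complex.I * ((0 : ℝ) : ℂ) * x)) = 1 := by
    rw [← hc.map_one]
    congr 1
    ext x
    simp
  have hstar : ∀ t : ℝ, star (E.bounded fun x => Complex.exp (Complex.I * t * x)) =
      E.bounded fun x => Complex.exp (Complex.I * ((-t : ℝ) : ℂ) * x) := by
    intro t
    rw [ContinuousLinearMap.star_eq_adjoint, ← hc.map_star (IsBoundedBorel.cexp t)]
    congr 1
    ext x
    simp [← Complex.exp_conj]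
  refine ⟨fun t => ?_, hzero, hadd, fun ξ => ?_⟩
  · rw [Unitary.mem_iff, hstar, ← hadd, ← hadd, neg_add_cancel, add_neg_cancel]
    exact ⟨hzero, hzero⟩
  · rw [continuous_iff_continuousAt]
    intro t
    have hb : ∀ t s : ℝ, ‖Complex.exp (Complex.I * t * s)‖ ≤ 1 := fun t s => by
      have : Complex.I * t * s = ((t * s : ℝ) : ℂ) * Complex.I := by push_cast; ring
      rw [this, Complex.norm_exp_ofReal_mul_I]
    refine hc.tendsto_apply (C := 1) (fun t => (IsBoundedBorel.cexp t).1) (IsBoundedBorel.cexp t)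
      hb (fun s => ?_) ξ
    have : Continuous fun t : ℝ => Complex.exp (Complex.I * t * s) := by fun_prop
    exact this.tendsto t

/-- `t ↦ e^{itT} ξ` is differentiable for `ξ` in the domain of `T`: the difference quotients of
`e^{its}` at `t = 0` are dominated by `|s|`, which is square integrable. -/
theorem ProjectionValuedMeasure.hasDerivAt_cexp {E : ProjectionValuedMeasure H} {T : H →ₗ.[ℂ] H}
    (hT : E.IsIntegral (fun s : ℝ => (s : ℂ)) T) (ξ : T.domain) :
    HasDerivAt (fun t : ℝ => E.bounded (fun s => Complex.exp (Complex.I * t * s)) (ξ : H))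
      (Complex.I • T ξ) 0 := by
  have hm : Measurable fun s : ℝ => (s : ℂ) := Complex.measurable_ofReal
  have hc := E.isBorelCalculus
  rw [hasDerivAt_iff_tendsto_slope_zero]
  let g : ℝ → ℝ → ℂ := fun t => (-Complex.I * (t : ℂ)⁻¹) •
    ((fun s : ℝ => Complex.exp (Complex.I * t * s)) - 1)
  have hone : IsBoundedBorel 1 := IsBoundedBorel.const 1
  have hg : ∀ t, IsBoundedBorel (g t) := fun t => ((IsBoundedBorel.cexp t).sub hone).smul _
  have hgb : ∀ t, E.bounded (g t) = (-Complex.I * (t : ℂ)⁻¹) •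
      (E.bounded (fun s : ℝ => Complex.exp (Complex.I * t * s)) - 1) := fun t => by
    rw [hc.map_smul _ ((IsBoundedBorel.cexp t).sub hone), hc.map_sub (IsBoundedBorel.cexp t) hone,
      hc.map_one]
  have hslope : ∀ t s : ℝ, ‖g t s‖ ≤ |s| := by
    intro t s
    simp only [g, Pi.smul_apply, Pi.sub_apply, Pi.one_apply, smul_eq_mul]
    rw [norm_mul, norm_mul, norm_neg, Complex.norm_I, one_mul, norm_inv, Complex.norm_real,
      Real.norm_eq_abs]
    have h1 := Real.norm_exp_I_mul_ofReal_sub_one_le (x := t * s)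
    rw [Complex.ofReal_mul, ← mul_assoc, Real.norm_eq_abs, abs_mul] at h1
    rcases eq_or_ne t 0 with rfl | ht
    · simp
    · have : 0 < |t| := abs_pos.2 ht
      rw [inv_mul_le_iff₀ this]
      exact h1
  have hpt : ∀ s : ℝ, Tendsto (fun t => g t s) (𝓝[≠] 0) (𝓝 (s : ℂ)) := by
    intro s
    have h1 : HasDerivAt (fun t : ℝ => Complex.exp (Complex.I * t * s))
        (Complex.exp (Complex.I * (0 : ℝ) * s) * (Complex.I * s)) 0 := by
      have h2 : HasDerivAt (fun t : ℝ => Complex.I * t * s) (Complex.I * 1 * s) 0 :=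
        ((Complex.ofRealCLM.hasDerivAt (x := 0)).const_mul Complex.I).mul_const (s : ℂ)
      rw [mul_one] at h2
      exact h2.cexp
    rw [hasDerivAt_iff_tendsto_slope_zero] at h1
    have h3 := h1.const_mul (-Complex.I)
    have e : -Complex.I * (Complex.exp (Complex.I * (0 : ℝ) * s) * (Complex.I * s)) = s := by
      simp only [Complex.ofReal_zero, mul_zero, zero_mul, Complex.exp_zero, one_mul]
      linear_combination (-(s : ℂ)) * Complex.I_sq
    rw [e] at h3
    refine h3.congr fun t => ?_
    simp [g, mul_assoc]
  have hlim : Tendsto (fun t => ‖E.bounded (g t) (ξ : H) - T ξ‖ ^ 2) (𝓝[≠] 0) (𝓝 0) := by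
    simp only [fun t => hT.norm_bounded_sub_sq hm ξ (hg t)]
    have hmem := (hT.mem_domain_iff _).1 ξ.2
    have hint := (memLp_two_iff_integrable_sq_norm hm.aestronglyMeasurable).1 hmem
    have : Tendsto (fun t => ∫ s, ‖g t s - s‖ ^ 2 ∂(E.measure (ξ : H))) (𝓝[≠] 0)
        (𝓝 (∫ _, (0 : ℝ) ∂(E.measure (ξ : H)))) := by
      refine tendsto_integral_filter_of_dominated_convergence (fun s => 4 * ‖(s : ℂ)‖ ^ 2)
        (Eventually.of_forall fun t =>
          (((hg t).1.sub hm).norm.pow_const 2).aestronglyMeasurable)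
        (Eventually.of_forall fun t => ae_of_all _ fun s => ?_) (hint.const_mul 4)
        (ae_of_all _ fun s => ?_)
      · rw [Real.norm_of_nonneg (by positivity), Complex.norm_real, Real.norm_eq_abs]
        have h1 : ‖g t s - s‖ ≤ 2 * |s| := by
          refine (norm_sub_le _ _).trans ?_
          rw [Complex.norm_real, Real.norm_eq_abs]
          linarith [hslope t s]
        exact (pow_le_pow_left₀ (norm_nonneg _) h1 2).trans_eq (by ring)
      · have := (tendsto_iff_norm_sub_tendsto_zero.1 (hpt s)).pow 2
        simpa using this
    simpa using this
  have hlim' : Tendsto (fun t => E.bounded (g t) (ξ : H)) (𝓝[≠] 0) (𝓝 (T ξ)) := by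
    rw [tendsto_iff_norm_sub_tendsto_zero]
    simpa using hlim.sqrt
  refine (hlim'.const_smul Complex.I).congr fun t => ?_
  have h0 : E.bounded (fun s => Complex.exp (Complex.I * ((0 : ℝ) : ℂ) * s)) = 1 :=
    E.isOneParameterUnitaryGroup.map_zero
  rw [hgb, zero_add, h0, smul_apply, smul_smul, sub_apply, ← mul_assoc, mul_neg, Complex.I_mul_I,
    neg_neg, one_mul, ← Complex.ofReal_inv]
  rfl

/-- **Stone's theorem**: every strongly continuous one-parameter unitary group is `e^{itT}` for a
self-adjoint operator `T`. The group and `e^{itT}` have the same generator, which determines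
them. -/
theorem IsOneParameterUnitaryGroup.exists_expI_eq {U : ℝ → H →L[ℂ] H}
    (hU : IsOneParameterUnitaryGroup U) :
    ∃ T : H →ₗ.[ℂ] H, IsSelfAdjoint T ∧ ∀ t, expI T t = (U t : H →ₗ[ℂ] H).toPMap ⊤ := by
  obtain ⟨T, hT, hgen⟩ := hU.exists_generator
  refine ⟨T, hT, fun t => ?_⟩
  let V : ℝ → H →L[ℂ] H := fun t =>
    (spectralMeasure T).bounded fun s => Complex.exp (Complex.I * t * s)
  have hV : IsOneParameterUnitaryGroup V := (spectralMeasure T).isOneParameterUnitaryGroup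
  -- `U` and `V` have the same generator
  obtain ⟨S, hS, hSgen⟩ := hV.exists_generator
  have hTS : T = S := by
    refine LinearPMap.eq_of_le_of_isSelfAdjoint hT
      (LinearPMap.inner_apply_eq_of_isSelfAdjoint hS) ?_
    have key : ∀ x : T.domain, ∃ h : (x : H) ∈ S.domain, S ⟨x, h⟩ = T x := fun x =>
      (hSgen x (T x)).2 (ProjectionValuedMeasure.hasDerivAt_cexp (isIntegral_spectralMeasure hT) x)
    refine ⟨fun x hx => (key ⟨x, hx⟩).1, fun x y hxy => ?_⟩
    obtain ⟨h, h'⟩ := key x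
    rw [← h']
    congr 1
    exact Subtype.ext hxy
  subst hTS
  -- a unitary group leaves the domain of its generator invariant and commutes with it
  have hinv : ∀ {W : ℝ → H →L[ℂ] H}, IsOneParameterUnitaryGroup W →
      (∀ ξ η : H, (∃ h : ξ ∈ T.domain, T ⟨ξ, h⟩ = η) ↔
        HasDerivAt (fun t => W t ξ) (Complex.I • η) 0) →
      ∀ (x : T.domain) (t : ℝ), ∃ h : W t x ∈ T.domain, T ⟨W t x, h⟩ = W t (T x) := by
    intro W hW hWgen x t
    refine (hWgen _ _).2 ?_
    have h1 := (hWgen x (T x)).1 ⟨x.2, rfl⟩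
    have h2 := ((W t).restrictScalars ℝ).hasFDerivAt.comp_hasDerivAt 0 h1
    have h3 : ((W t).restrictScalars ℝ) (Complex.I • T x) = Complex.I • W t (T x) :=
      (W t).map_smul _ _
    rw [h3] at h2
    refine h2.congr_of_eventuallyEq (Eventually.of_forall fun s => ?_)
    change W s (W t x) = W t (W s x)
    rw [← hW.apply_add, ← hW.apply_add, add_comm]
  -- the derivative of `⟨V(t) x, U(t) y⟩` vanishes by symmetry of the generator
  have hconst : ∀ (x y : T.domain) (t : ℝ), inner ℂ (V t x) (U t y) = inner ℂ (x : H) (y : H) := by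
    intro x y t
    have hd : ∀ t, HasDerivAt (fun t => inner ℂ (V t x) (U t y)) (0 : ℂ) t := by
      intro t
      have h1 := hV.hasDerivAt ((hSgen x (T x)).1 ⟨x.2, rfl⟩) t
      have h2 := hU.hasDerivAt ((hgen y (T y)).1 ⟨y.2, rfl⟩) t
      refine (h1.inner ℂ h2).congr_deriv ?_
      obtain ⟨ha, ha'⟩ := hinv hV hSgen x t
      obtain ⟨hb, hb'⟩ := hinv hU hgen y t
      have h3 := LinearPMap.inner_apply_eq_of_isSelfAdjoint hT ⟨_, ha⟩ ⟨_, hb⟩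
      rw [ha', hb'] at h3
      rw [_root_.map_smul, _root_.map_smul, inner_smul_left, inner_smul_right, h3, Complex.conj_I]
      ring
    have := is_const_of_deriv_eq_zero (fun t => (hd t).differentiableAt) (fun t => (hd t).deriv) t 0
    simpa only [hV.map_zero, hU.map_zero, one_apply_eq_self] using this
  have hVU : V t = U t := by
    have hdense := hT.dense_domain
    have h1 : ∀ y : T.domain, star (V t) (U t y) = y := by
      intro y
      refine hdense.eq_of_inner_right ℂ fun x hx => ?_
      rw [ContinuousLinearMap.star_eq_adjoint, ContinuousLinearMap.adjoint_inner_right]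
      exact hconst ⟨x, hx⟩ y t
    have h2 : star (V t) * U t = 1 := by
      refine DFunLike.coe_injective (Continuous.ext_on hdense
        (star (V t) * U t).continuous continuous_id fun y hy => h1 ⟨y, hy⟩)
    have h3 := congrArg (V t * ·) h2
    simp only [← mul_assoc, (Unitary.mem_iff.1 (hV.mem_unitary t)).2, one_mul, mul_one] at h3
    exact h3.symm
  rw [expI_eq, ← hVU]

end Stone

/-! ### Operations on fibres of a direct integral -/

section DirectIntegralFibres

open Filter Topology

variable {X : Type*} [MeasurableSpace X] {ν : Measure X}
  {𝓚 : X → Type*} [∀ x, NormedAddCommGroup (𝓚 x)] [∀ x, InnerProductSpace ℂ (𝓚 x)]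
  {K : Type*} [NormedAddCommGroup K] [InnerProductSpace ℂ K]

namespace DirectIntegral

variable (D : DirectIntegral ν 𝓚 K)

/-- The fibre map is linear almost everywhere: the defect `w` of linearity pairs to zero in the
integral with every element of `K`, hence with itself, so that `∫ ‖w‖² = 0`. -/
theorem ae_fibre_add_smul (ξ η : K) (c : ℂ) :
    ∀ᵐ x ∂ν, D.fibre (ξ + c • η) x = D.fibre ξ x + c • D.fibre η x := by
  set ζ := ξ + c • η
  let w : ∀ x, 𝓚 x := fun x => D.fibre ζ x - (D.fibre ξ x + c • D.fibre η x)
  have hw : ∀ θ : K, Integrable (fun x => inner ℂ (D.fibre θ x) (w x)) ν ∧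
      ∫ x, inner ℂ (D.fibre θ x) (w x) ∂ν = 0 := by
    intro θ
    have h1 := D.integrable_inner θ ζ
    have h2 := D.integrable_inner θ ξ
    have h3 := (D.integrable_inner θ η).const_mul c
    have e : (fun x => inner ℂ (D.fibre θ x) (w x)) = fun x =>
        inner ℂ (D.fibre θ x) (D.fibre ζ x) - (inner ℂ (D.fibre θ x) (D.fibre ξ x) +
          c * inner ℂ (D.fibre θ x) (D.fibre η x)) := by
      ext x
      simp only [w, inner_sub_right, inner_add_right, inner_smul_right]
    have h23 : Integrable (fun x => inner ℂ (D.fibre θ x) (D.fibre ξ x) +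
        c * inner ℂ (D.fibre θ x) (D.fibre η x)) ν := h2.add h3
    rw [e]
    refine ⟨h1.sub h23, ?_⟩
    rw [integral_sub h1 h23, integral_add h2 h3, integral_const_mul, ← D.inner_eq,
      ← D.inner_eq, ← D.inner_eq]
    simp only [ζ, inner_add_right, inner_smul_right, sub_self]
  have h1 := (hw ζ).1
  have h2 := (hw ξ).1
  have h3 := (hw η).1.const_mul (starRingEnd ℂ c)
  have e : (fun x => inner ℂ (w x) (w x)) = fun x =>
      inner ℂ (D.fibre ζ x) (w x) - (inner ℂ (D.fibre ξ x) (w x) +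
        starRingEnd ℂ c * inner ℂ (D.fibre η x) (w x)) := by
    ext x
    rw [← inner_smul_left, ← inner_add_left, ← inner_sub_left]
  have h23 : Integrable (fun x => inner ℂ (D.fibre ξ x) (w x) +
      starRingEnd ℂ c * inner ℂ (D.fibre η x) (w x)) ν := h2.add h3
  have hi : Integrable (fun x => inner ℂ (w x) (w x)) ν := by
    rw [e]
    exact h1.sub h23
  have h0 : ∫ x, inner ℂ (w x) (w x) ∂ν = 0 := by
    rw [e, integral_sub h1 h23, integral_add h2 h3, integral_const_mul, (hw ζ).2,
      (hw ξ).2, (hw η).2]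
    simp
  have hr : ∫ x, (inner ℂ (w x) (w x)).re ∂ν = 0 := by
    have h4 : ∫ x, (inner ℂ (w x) (w x)).re ∂ν = (∫ x, inner ℂ (w x) (w x) ∂ν).re :=
      integral_re hi
    rw [h4, h0, Complex.zero_re]
  have hae := (integral_eq_zero_iff_of_nonneg (fun x => inner_self_nonneg (𝕜 := ℂ)) hi.re).1 hr
  filter_upwards [hae] with x hx
  have hx' : RCLike.re (inner ℂ (w x) (w x)) = 0 := hx
  rw [inner_self_eq_norm_sq] at hx'
  exact sub_eq_zero.1 (norm_eq_zero.1 (pow_eq_zero_iff two_ne_zero |>.1 hx'))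

theorem ae_fibre_zero : ∀ᵐ x ∂ν, D.fibre 0 x = 0 := by
  filter_upwards [D.ae_fibre_add_smul 0 0 1] with x hx
  simpa using hx

theorem ae_fibre_add (ξ η : K) :
    ∀ᵐ x ∂ν, D.fibre (ξ + η) x = D.fibre ξ x + D.fibre η x := by
  simpa using D.ae_fibre_add_smul ξ η 1

theorem ae_fibre_smul (c : ℂ) (η : K) : ∀ᵐ x ∂ν, D.fibre (c • η) x = c • D.fibre η x := by
  filter_upwards [D.ae_fibre_add_smul 0 η c, D.ae_fibre_zero] with x h1 h2
  rw [zero_add] at h1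
  rw [h1, h2, zero_add]

theorem ae_fibre_sub (ξ η : K) :
    ∀ᵐ x ∂ν, D.fibre (ξ - η) x = D.fibre ξ x - D.fibre η x := by
  simpa [sub_eq_add_neg] using D.ae_fibre_add_smul ξ η (-1)

theorem eLpNorm_norm_fibre (ξ : K) :
    eLpNorm (fun x => ‖D.fibre ξ x‖) 2 ν = ENNReal.ofReal ‖ξ‖ ∧
      AEStronglyMeasurable (fun x => ‖D.fibre ξ x‖) ν := by
  have e : (fun x => (inner ℂ (D.fibre ξ x) (D.fibre ξ x)).re) = fun x => ‖D.fibre ξ x‖ ^ 2 := by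
    ext x
    exact inner_self_eq_norm_sq (𝕜 := ℂ) _
  have hi : Integrable (fun x => ‖D.fibre ξ x‖ ^ 2) ν := by
    rw [← e]
    exact (D.integrable_inner ξ ξ).re
  have hm : AEStronglyMeasurable (fun x => ‖D.fibre ξ x‖) ν := by
    have := Real.continuous_sqrt.comp_aestronglyMeasurable hi.aestronglyMeasurable
    simpa using this
  have hmem : MemLp (fun x => ‖D.fibre ξ x‖) 2 ν := by
    rw [memLp_two_iff_integrable_sq_norm hm]
    simpa using hi
  have hnorm : ∫ x, ‖D.fibre ξ x‖ ^ 2 ∂ν = ‖ξ‖ ^ 2 := by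
    rw [← e, ← inner_self_eq_norm_sq (𝕜 := ℂ) ξ, D.inner_eq]
    exact integral_re (D.integrable_inner ξ ξ)
  refine ⟨?_, hm⟩
  rw [hmem.eLpNorm_eq_integral_rpow_norm two_ne_zero ENNReal.ofNat_ne_top]
  congr 1
  have h1 : ∫ x, ‖‖D.fibre ξ x‖‖ ^ (2 : ENNReal).toReal ∂ν = ‖ξ‖ ^ 2 := by
    rw [← hnorm]
    refine integral_congr_ae (ae_of_all _ fun x => ?_)
    simp
  rw [h1, ENNReal.toReal_ofNat, ← one_div, ← Real.sqrt_eq_rpow, Real.sqrt_sq (norm_nonneg _)]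

/-- A convergent sequence of vectors has a subsequence converging in almost every fibre. -/
theorem exists_subseq_tendsto_fibre {u : ℕ → K} {ξ : K} (hu : Tendsto u atTop (𝓝 ξ)) :
    ∃ φ : ℕ → ℕ, StrictMono φ ∧
      ∀ᵐ x ∂ν, Tendsto (fun n => D.fibre (u (φ n)) x) atTop (𝓝 (D.fibre ξ x)) := by
  have hmeas : TendstoInMeasure ν (fun n x => ‖D.fibre (u n - ξ) x‖) atTop fun _ => (0 : ℝ) := by
    refine tendstoInMeasure_of_tendsto_eLpNorm (p := 2) two_ne_zero
      (fun n => (D.eLpNorm_norm_fibre _).2) aestronglyMeasurable_const ?_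
    have h1 : Tendsto (fun n => ENNReal.ofReal ‖u n - ξ‖) atTop (𝓝 0) := by
      simpa using ENNReal.tendsto_ofReal (tendsto_iff_norm_sub_tendsto_zero.1 hu)
    refine h1.congr fun n => ?_
    rw [← (D.eLpNorm_norm_fibre (u n - ξ)).1]
    congr 1
    ext x
    simp
  obtain ⟨φ, hφ, hlim⟩ := hmeas.exists_seq_tendsto_ae
  refine ⟨φ, hφ, ?_⟩
  filter_upwards [hlim, ae_all_iff.2 fun n => D.ae_fibre_sub (u n) ξ] with x hx hsub
  rw [tendsto_iff_norm_sub_tendsto_zero]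
  simpa only [hsub] using hx

theorem decomposes_toPMap_top_iff {A : K →L[ℂ] K} {a : ∀ x, 𝓚 x →L[ℂ] 𝓚 x} :
    (D.Decomposes ((A : K →ₗ[ℂ] K).toPMap ⊤) fun x => (a x : 𝓚 x →ₗ[ℂ] 𝓚 x).toPMap ⊤) ↔
      D.DecomposesBounded A a := by
  constructor
  · intro h ξ
    filter_upwards [h ⟨ξ, trivial⟩] with x hx
    exact hx.2
  · intro h ξ
    filter_upwards [h ξ] with x hx
    exact ⟨trivial, hx⟩

end DirectIntegral

end DirectIntegralFibres

/-! ### Decomposition of Borel functional calculi -/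

section Decomposition

open Filter Topology

variable {X : Type*} [MeasurableSpace X] {ν : Measure X}
  {𝓚 : X → Type*} [∀ x, NormedAddCommGroup (𝓚 x)] [∀ x, InnerProductSpace ℂ (𝓚 x)]
  [∀ x, CompleteSpace (𝓚 x)]
  {K : Type*} [NormedAddCommGroup K] [InnerProductSpace ℂ K] [CompleteSpace K]

namespace ProjectionValuedMeasure

theorem norm_bounded_truncate_mono {H : Type*} [NormedAddCommGroup H] [InnerProductSpace ℂ H]
    [CompleteSpace H] (E : ProjectionValuedMeasure H) {f : ℝ → ℂ} (hf : Measurable f) {m n : ℕ}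
    (hmn : m ≤ n) (ξ : H) :
    ‖E.bounded (truncate f m) ξ‖ ≤ ‖E.bounded (truncate f n) ξ‖ := by
  have hmn' : (m : ℝ) ≤ n := by exact_mod_cast hmn
  refine abs_le_of_sq_le_sq' ?_ (norm_nonneg _) |>.2
  have hb := IsBoundedBorel.truncate hf
  rw [E.isBorelCalculus.norm_sq_apply (hb m), E.isBorelCalculus.norm_sq_apply (hb n)]
  refine integral_mono_of_nonneg (ae_of_all _ fun s => by positivity) ?_ (ae_of_all _ fun s => ?_)
  · refine Integrable.of_bound ((hb n).1.norm.pow_const 2).aestronglyMeasurable ((n : ℝ) ^ 2)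
      (ae_of_all _ fun s => ?_)
    rw [Real.norm_of_nonneg (by positivity)]
    exact pow_le_pow_left₀ (norm_nonneg _) (norm_truncate_le f n s) 2
  · refine pow_le_pow_left₀ (norm_nonneg _) ?_ 2
    by_cases h1 : ‖f s‖ ≤ m
    · have h2 : ‖f s‖ ≤ n := h1.trans hmn'
      simp [truncate, Set.indicator, h1, h2]
    · by_cases h2 : ‖f s‖ ≤ n <;> simp [truncate, Set.indicator, h1, h2]

end ProjectionValuedMeasure

namespace DirectIntegral

variable (D : DirectIntegral ν 𝓚 K) {E : ProjectionValuedMeasure K}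
  {e : ∀ x, ProjectionValuedMeasure (𝓚 x)}

/-- The functions `f` for which `∫ f dE` decomposes are stable under bounded pointwise limits, since
strong convergence of operators gives convergence in almost every fibre along a subsequence. -/
theorem isBoundedClosed_decomposesBounded : IsBoundedClosed fun f =>
    D.DecomposesBounded (E.bounded f) fun x => (e x).bounded f := by
  refine ⟨fun f g hf hg h₁ h₂ ξ => ?_, fun c f hf h ξ => ?_, fun F f C hF hf hC hlim h ξ => ?_⟩
  · filter_upwards [h₁ ξ, h₂ ξ, D.ae_fibre_add (E.bounded f ξ) (E.bounded g ξ)] with x h1 h2 h3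
    rw [E.isBorelCalculus.map_add hf hg, (e x).isBorelCalculus.map_add hf hg, add_apply, add_apply,
      h3, h1, h2]
  · filter_upwards [h ξ, D.ae_fibre_smul c (E.bounded f ξ)] with x h1 h2
    rw [E.isBorelCalculus.map_smul c hf, (e x).isBorelCalculus.map_smul c hf, smul_apply,
      smul_apply, h2, h1]
  · have hfb : IsBoundedBorel f :=
      ⟨hf, C, fun s => le_of_tendsto (hlim s).norm (Eventually.of_forall fun n => hC n s)⟩
    obtain ⟨φ, hφ, hφlim⟩ := D.exists_subseq_tendsto_fibre
      (E.isBorelCalculus.tendsto_apply hF hfb hC hlim ξ)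
    filter_upwards [hφlim, ae_all_iff.2 fun n => h n ξ] with x hx hn
    refine tendsto_nhds_unique hx ?_
    simp only [hn]
    exact ((e x).isBorelCalculus.tendsto_apply hF hfb hC hlim _).comp hφ.tendsto_atTop

theorem decomposesBounded_mul {f g : ℝ → ℂ} (hf : IsBoundedBorel f) (hg : IsBoundedBorel g)
    (h₁ : D.DecomposesBounded (E.bounded f) fun x => (e x).bounded f)
    (h₂ : D.DecomposesBounded (E.bounded g) fun x => (e x).bounded g) :
    D.DecomposesBounded (E.bounded (f * g)) fun x => (e x).bounded (f * g) := by
  intro ξ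
  filter_upwards [h₁ (E.bounded g ξ), h₂ ξ] with x h1 h2
  rw [E.isBorelCalculus.map_mul f g hf hg, (e x).isBorelCalculus.map_mul f g hf hg,
    mul_apply_eq_comp, mul_apply_eq_comp, h1, h2]

theorem decomposesPVM_iff : D.DecomposesPVM E e ↔ ∀ f, IsBoundedBorel f →
    D.DecomposesBounded (E.bounded f) fun x => (e x).bounded f := by
  constructor
  · intro h
    refine D.isBoundedClosed_decomposesBounded.of_indicator fun Ω hΩ => ?_
    simpa only [ProjectionValuedMeasure.bounded_indicator _ hΩ] using h Ω hΩ
  · intro h Ω hΩ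
    simpa only [ProjectionValuedMeasure.bounded_indicator _ hΩ] using
      h _ (IsBoundedBorel.indicator hΩ)

variable {D} in
/-- The decomposition passes to unbounded functions `f`: for `ξ` in the domain of `∫ f dE`, the
truncated integrals converge on `ξ(x)` along a subsequence, for almost every `x`. -/
theorem DecomposesPVM.integral (h : D.DecomposesPVM E e) {f : ℝ → ℂ} (hf : Measurable f) :
    D.Decomposes (E.integral f) fun x => (e x).integral f := by
  intro ξ
  have hb := D.decomposesPVM_iff.1 h
  obtain ⟨φ, hφ, hlim⟩ := D.exists_subseq_tendsto_fibre
    ((E.isIntegral_integral hf).tendsto_truncate hf ξ)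
  filter_upwards [hlim, ae_all_iff.2 fun n => hb _ (IsBoundedBorel.truncate hf n) ξ] with x hx hn
  simp only [hn] at hx
  have hA := (e x).isIntegral_integral hf
  obtain ⟨C, hC⟩ := hx.norm.bddAbove_range
  have hmem : D.fibre (ξ : K) x ∈ ((e x).integral f).domain := by
    refine (hA.mem_domain_iff _).2 ((e x).memLp_of_norm_bounded_le hf (C := C) fun n => ?_)
    exact ((e x).norm_bounded_truncate_mono hf (hφ.id_le n) _).trans (hC ⟨n, rfl⟩)
  exact ⟨hmem, tendsto_nhds_unique hx
    ((hA.tendsto_truncate hf ⟨_, hmem⟩).comp hφ.tendsto_atTop)⟩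

/-- It suffices to decompose the unitary group, because the functions `e^{its}` generate all bounded
Borel functions. -/
theorem decomposesPVM_iff_cexp : D.DecomposesPVM E e ↔ ∀ t : ℝ,
    D.DecomposesBounded (E.bounded fun s => Complex.exp (Complex.I * t * s)) fun x =>
      (e x).bounded fun s => Complex.exp (Complex.I * t * s) := by
  rw [D.decomposesPVM_iff]
  exact ⟨fun h t => h _ (IsBoundedBorel.cexp t),
    fun h => D.isBoundedClosed_decomposesBounded.of_cexp h⟩

end DirectIntegral

end Decomposition

/-! ### Resolvents determine the decomposition -/

section ResolventDecomposition

open Filter Topology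

theorem one_le_norm_one_sub_I_mul (a s : ℝ) : 1 ≤ ‖1 - Complex.I * a * s‖ := by
  have := Complex.abs_re_le_norm (1 - Complex.I * a * s)
  simpa using this

theorem one_sub_I_mul_ne_zero (a s : ℝ) : 1 - Complex.I * a * s ≠ 0 :=
  norm_pos_iff.1 (one_pos.trans_le (one_le_norm_one_sub_I_mul a s))

theorem norm_inv_one_sub_I_mul_le (a s : ℝ) : ‖(1 - Complex.I * a * s)⁻¹‖ ≤ 1 := by
  rw [norm_inv]
  exact inv_le_one_of_one_le₀ (one_le_norm_one_sub_I_mul a s)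

theorem isBoundedBorel_inv_one_sub_I_mul (a : ℝ) :
    IsBoundedBorel fun s : ℝ => (1 - Complex.I * a * s)⁻¹ :=
  ⟨by fun_prop, 1, norm_inv_one_sub_I_mul_le a⟩

/-- `(1 - iaT)⁻¹` maps into the domain of `T`, and is a right inverse of `1 - iaT`. -/
theorem ProjectionValuedMeasure.IsIntegral.exists_resolvent {H : Type*} [NormedAddCommGroup H]
    [InnerProductSpace ℂ H] [CompleteSpace H] {E : ProjectionValuedMeasure H} {T : H →ₗ.[ℂ] H}
    (hT : E.IsIntegral (fun s : ℝ => (s : ℂ)) T) {a : ℝ} (ha : a ≠ 0) (η : H) :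
    ∃ h : E.bounded (fun s => (1 - Complex.I * a * s)⁻¹) η ∈ T.domain,
      E.bounded (fun s => (1 - Complex.I * a * s)⁻¹) η -
        (Complex.I * a) • T ⟨E.bounded (fun s => (1 - Complex.I * a * s)⁻¹) η, h⟩ = η := by
  have hone : IsBoundedBorel 1 := IsBoundedBorel.const 1
  set g : ℝ → ℂ := fun s => (1 - Complex.I * a * s)⁻¹
  have hg : IsBoundedBorel g := isBoundedBorel_inv_one_sub_I_mul a
  have hIa : Complex.I * a ≠ 0 := mul_ne_zero Complex.I_ne_zero (Complex.ofReal_ne_zero.2 ha)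
  have hfg : (fun s : ℝ => (s : ℂ)) * g = (Complex.I * a)⁻¹ • (g - 1) := by
    ext s
    have h0 := one_sub_I_mul_ne_zero a s
    simp only [g, Pi.mul_apply, Pi.smul_apply, Pi.sub_apply, Pi.one_apply, smul_eq_mul]
    rw [eq_inv_mul_iff_mul_eq₀ hIa, eq_sub_iff_add_eq]
    rw [← mul_assoc]
    nth_rw 2 [← mul_inv_cancel₀ h0]
    ring
  obtain ⟨h, h'⟩ := hT.exists_apply_bounded Complex.measurable_ofReal hg
    (by rw [hfg]; exact (hg.sub hone).smul _) η
  refine ⟨h, ?_⟩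
  rw [h', hfg, E.isBorelCalculus.map_smul _ (hg.sub hone), E.isBorelCalculus.map_sub hg hone,
    E.isBorelCalculus.map_one, smul_apply, smul_smul, mul_inv_cancel₀ hIa, one_smul, sub_apply,
    one_apply_eq_self, sub_sub_cancel]

variable {X : Type*} [MeasurableSpace X] {ν : Measure X}
  {𝓚 : X → Type*} [∀ x, NormedAddCommGroup (𝓚 x)] [∀ x, InnerProductSpace ℂ (𝓚 x)]
  [∀ x, CompleteSpace (𝓚 x)]
  {K : Type*} [NormedAddCommGroup K] [InnerProductSpace ℂ K] [CompleteSpace K]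

namespace DirectIntegral

variable {D : DirectIntegral ν 𝓚 K} {E : ProjectionValuedMeasure K}
  {e : ∀ x, ProjectionValuedMeasure (𝓚 x)} {T : K →ₗ.[ℂ] K} {τ : ∀ x, 𝓚 x →ₗ.[ℂ] 𝓚 x}

/-- If `T` decomposes, then so do its resolvents `(1 - iaT)⁻¹`, because `1 - iaT_x` is injective in
each fibre. -/
theorem Decomposes.resolvent (h : D.Decomposes T τ)
    (hT : E.IsIntegral (fun s : ℝ => (s : ℂ)) T)
    (he : ∀ x, (e x).IsIntegral (fun s : ℝ => (s : ℂ)) (τ x))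
    (hτ : ∀ x, IsSelfAdjoint (τ x)) {a : ℝ} (ha : a ≠ 0) :
    D.DecomposesBounded (E.bounded fun s => (1 - Complex.I * a * s)⁻¹) fun x =>
      (e x).bounded fun s => (1 - Complex.I * a * s)⁻¹ := by
  intro η
  obtain ⟨hmem, hη⟩ := hT.exists_resolvent ha η
  set g : ℝ → ℂ := fun s => (1 - Complex.I * a * s)⁻¹
  set ξ := E.bounded g η
  filter_upwards [h ⟨ξ, hmem⟩, D.ae_fibre_sub ξ ((Complex.I * a) • T ⟨ξ, hmem⟩),
    D.ae_fibre_smul (Complex.I * a) (T ⟨ξ, hmem⟩)] with x hx h1 h2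
  obtain ⟨hxm, hx⟩ := hx
  rw [hη, h2, hx] at h1
  obtain ⟨hzm, hz⟩ := (he x).exists_resolvent ha (D.fibre η x)
  set ζ := (e x).bounded g (D.fibre η x)
  -- `ξ(x) - ζ` is in the kernel of `1 - iaT_x = -ia (T_x + i/a)`
  rw [← sub_eq_zero]
  refine LinearPMap.eq_zero_of_apply_add_smul_I_eq_zero
    (LinearPMap.inner_apply_eq_of_isSelfAdjoint (hτ x)) (inv_ne_zero ha)
    (x := ⟨D.fibre ξ x, hxm⟩ - ⟨ζ, hzm⟩) ?_
  have hIa : Complex.I * a ≠ 0 := mul_ne_zero Complex.I_ne_zero (Complex.ofReal_ne_zero.2 ha)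
  refine smul_right_injective _ hIa ?_
  have hca : Complex.I * a * (((a⁻¹ : ℝ) : ℂ) * Complex.I) = -1 := by
    have : (a : ℂ) ≠ 0 := Complex.ofReal_ne_zero.2 ha
    rw [Complex.ofReal_inv]
    field_simp
    exact Complex.I_sq
  simp only [LinearPMap.map_sub, Submodule.coe_sub, smul_add, smul_smul, hca, smul_sub, smul_zero]
  have h3 := h1.symm.trans hz.symm
  rw [neg_one_smul, neg_one_smul]
  rw [← neg_eq_zero, ← sub_eq_zero.2 h3]
  abel

/-- Since `e^{its} = lim (1 - its/n)⁻ⁿ`, boundedly in `s`, the resolvents generate the bounded Borel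
calculus. -/
theorem Decomposes.decomposesPVM (h : D.Decomposes T τ)
    (hT : E.IsIntegral (fun s : ℝ => (s : ℂ)) T)
    (he : ∀ x, (e x).IsIntegral (fun s : ℝ => (s : ℂ)) (τ x))
    (hτ : ∀ x, IsSelfAdjoint (τ x)) : D.DecomposesPVM E e := by
  have hcl := D.isBoundedClosed_decomposesBounded (E := E) (e := e)
  have hone : D.DecomposesBounded (E.bounded 1) fun x => (e x).bounded 1 := by
    intro ξ
    refine ae_of_all _ fun x => ?_
    change D.fibre (E.bounded 1 ξ) x = (e x).bounded 1 (D.fibre ξ x)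
    rw [E.isBorelCalculus.map_one, (e x).isBorelCalculus.map_one]
    rfl
  refine D.decomposesPVM_iff_cexp.2 fun t => ?_
  rcases eq_or_ne t 0 with rfl | ht
  · have h0 : (fun s : ℝ => Complex.exp (Complex.I * ((0 : ℝ) : ℂ) * s)) = 1 := by
      ext s
      simp
    rw [h0]
    exact hone
  let g : ℕ → ℝ → ℂ := fun n s => (1 - Complex.I * ((t / (n + 1 : ℕ) : ℝ) : ℂ) * s)⁻¹
  have hg : ∀ n, IsBoundedBorel (g n) := fun n => isBoundedBorel_inv_one_sub_I_mul _
  have hpow : ∀ n k : ℕ, IsBoundedBorel (g n ^ k) ∧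
      D.DecomposesBounded (E.bounded (g n ^ k)) fun x => (e x).bounded (g n ^ k) := by
    intro n k
    induction k with
    | zero =>
      rw [pow_zero]
      exact ⟨IsBoundedBorel.const 1, hone⟩
    | succ k ih =>
      rw [pow_succ]
      exact ⟨ih.1.mul (hg n), D.decomposesBounded_mul ih.1 (hg n) ih.2
        (h.resolvent hT he hτ (div_ne_zero ht (by positivity)))⟩
  refine hcl.lim (fun n => g n ^ (n + 1)) _ 1 (fun n => (hpow n _).1.1) (IsBoundedBorel.cexp t).1
    (fun n s => ?_) (fun s => ?_) fun n => (hpow n _).2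
  · rw [Pi.pow_apply, norm_pow]
    exact pow_le_one₀ (norm_nonneg _) (norm_inv_one_sub_I_mul_le _ s)
  · have h1 := (Complex.tendsto_one_add_div_pow_exp (-(Complex.I * t * s))).inv₀
      (Complex.exp_ne_zero _)
    rw [← Complex.exp_neg, neg_neg] at h1
    refine (h1.comp (tendsto_add_atTop_nat 1)).congr fun n => ?_
    simp only [Function.comp_apply, g, Pi.pow_apply]
    rw [← inv_pow]
    congr 2
    push_cast
    ring

end DirectIntegral

end ResolventDecomposition

/-! ### The equivalences -/

/-- The equivalences for fixed fibre operators. -/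
theorem DirectIntegral.tfae_decomposes {X : Type*} [MeasurableSpace X] {ν : Measure X}
    {𝓚 : X → Type*} [∀ x, NormedAddCommGroup (𝓚 x)] [∀ x, InnerProductSpace ℂ (𝓚 x)]
    [∀ x, CompleteSpace (𝓚 x)] {K : Type*} [NormedAddCommGroup K] [InnerProductSpace ℂ K]
    [CompleteSpace K] (D : DirectIntegral ν 𝓚 K) {T : K →ₗ.[ℂ] K} (hT : IsSelfAdjoint T)
    {τ : ∀ x, 𝓚 x →ₗ.[ℂ] 𝓚 x} (hτ : ∀ x, IsSelfAdjoint (τ x)) :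
    List.TFAE [
      D.DecomposesPVM (spectralMeasure T) fun x => spectralMeasure (τ x),
      ∀ f : ℝ → ℂ, Measurable f →
        D.Decomposes (borelCalculus T f) fun x => borelCalculus (τ x) f,
      D.Decomposes T τ,
      ∀ t : ℝ, D.Decomposes (expI T t) fun x => expI (τ x) t] := by
  tfae_have 1 → 2 := fun h f hf => h.integral hf
  tfae_have 2 → 3 := fun h => by
    have := h _ Complex.measurable_ofReal
    simpa only [borelCalculus_ofReal hT, fun x => borelCalculus_ofReal (hτ x)] using this
  tfae_have 3 → 1 := fun h => h.decomposesPVM (isIntegral_spectralMeasure hT)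
    (fun x => isIntegral_spectralMeasure (hτ x)) hτ
  tfae_have 1 ↔ 4 := by
    simp only [D.decomposesPVM_iff_cexp, expI_eq, D.decomposes_toPMap_top_iff]
  tfae_finish

theorem mainTheorem10
    {X : Type*} [TopologicalSpace X] [LocallyCompactSpace X] [SigmaCompactSpace X]
    [MeasurableSpace X] [OpensMeasurableSpace X] (ν : Measure X)
    (𝓚 : X → Type*) [∀ x, NormedAddCommGroup (𝓚 x)] [∀ x, InnerProductSpace ℂ (𝓚 x)]
    [∀ x, CompleteSpace (𝓚 x)] [∀ x, TopologicalSpace.SeparableSpace (𝓚 x)]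
    (K : Type*) [NormedAddCommGroup K] [InnerProductSpace ℂ K]
    [CompleteSpace K] [TopologicalSpace.SeparableSpace K]
    (D : DirectIntegral ν 𝓚 K) (T : K →ₗ.[ℂ] K) (hT : IsSelfAdjoint T) :
    List.TFAE [
      ∃ τ : ∀ x, 𝓚 x →ₗ.[ℂ] 𝓚 x, (∀ x, IsSelfAdjoint (τ x)) ∧
        D.DecomposesPVM (spectralMeasure T) fun x => spectralMeasure (τ x),
      ∃ τ : ∀ x, 𝓚 x →ₗ.[ℂ] 𝓚 x, (∀ x, IsSelfAdjoint (τ x)) ∧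
        ∀ f : ℝ → ℂ, Measurable f →
          D.Decomposes (borelCalculus T f) fun x => borelCalculus (τ x) f,
      ∃ τ : ∀ x, 𝓚 x →ₗ.[ℂ] 𝓚 x, (∀ x, IsSelfAdjoint (τ x)) ∧ D.Decomposes T τ,
      ∃ U : ∀ x, ℝ → 𝓚 x →L[ℂ] 𝓚 x, (∀ x, IsOneParameterUnitaryGroup (U x)) ∧
        ∀ t : ℝ, D.Decomposes (expI T t)
          fun x => (U x t : 𝓚 x →ₗ[ℂ] 𝓚 x).toPMap ⊤] ∧
    ∀ τ : ∀ x, 𝓚 x →ₗ.[ℂ] 𝓚 x, (∀ x, IsSelfAdjoint (τ x)) →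
      List.TFAE [
        D.DecomposesPVM (spectralMeasure T) fun x => spectralMeasure (τ x),
        ∀ f : ℝ → ℂ, Measurable f →
          D.Decomposes (borelCalculus T f) fun x => borelCalculus (τ x) f,
        D.Decomposes T τ,
        ∀ t : ℝ, D.Decomposes (expI T t) fun x => expI (τ x) t] := by
  refine ⟨?_, fun τ hτ => D.tfae_decomposes hT hτ⟩
  tfae_have 1 → 2 := fun ⟨τ, hτ, h⟩ => ⟨τ, hτ, ((D.tfae_decomposes hT hτ).out 0 1).1 h⟩
  tfae_have 2 → 3 := fun ⟨τ, hτ, h⟩ => ⟨τ, hτ, ((D.tfae_decomposes hT hτ).out 1 2).1 h⟩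
  tfae_have 3 → 4 := fun ⟨τ, hτ, h⟩ => by
    have h4 := ((D.tfae_decomposes hT hτ).out 2 3).1 h
    simp only [expI_eq (τ _)] at h4
    exact ⟨_, fun x => (spectralMeasure (τ x)).isOneParameterUnitaryGroup, h4⟩
  tfae_have 4 → 1 := by
    rintro ⟨U, hU, h⟩
    choose τ hτ hexp using fun x => (hU x).exists_expI_eq
    refine ⟨τ, hτ, ((D.tfae_decomposes hT hτ).out 3 0).1 fun t => ?_⟩
    simp only [hexp]
    exact h t
  tfae_finish
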